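/- **Signal machines.** A *signal machine* consists of a finite set of meta-signals, a real speed for each meta-signal, and a collision function that maps every set $\rho^-$ of at least two meta-signals with pairwise distinct speeds to a set $\rho^+$ of meta-signals with pairwise distinct speeds (the rule $\rho^-\to\rho^+$). It is an *$n$-speed machine* if exactly $n$ speeds occur. A configuration assigns to each $x\in\mathbb R$ nothing (void), a signal, a collision rule, or the value $\ast$ (accumulation), such that signals and collisions are isolated and every accumulation point of the non-void positions has value $\ast$. An initial configuration has finitely many non-void positions and no $\ast$, and may also hold several signals of pairwise distinct speeds at one position. We write $\{\mu_1@x_1,\dots,\mu_k@x_k\}$ for a configuration given by its signals; several signals at one position of a configuration at a positive time stand for any collision that produces them. *Dynamics.* A signal of speed $s$ moves along $x+s\,\Delta t$. When at least two signals meet, the set $\rho^-$ of all incoming meta-signals is replaced by the signals of $\rho^+$. The collision times are $t_0=0$ and $t_{n+1}=t_n+\Delta_n$, with $\Delta_n>0$ the time to the next collision. If this sequence is infinite with a finite limit $T$, the configuration at time $T$ has value $\ast$ at each $x$ such that collisions occur at positions arbitrarily close to $x$ and times before $T$ arbitrarily close to $T$; elsewhere it consists of what the arriving signals produce. The machine *produces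 an accumulation* at $(x,T)$ if the collision times are infinite in number and converge to $T$, the value at $(x,T)$ is $\ast$, every point of the diagram over $[0,T]$ near $(x,T)$, other than $(x,T)$, outside of the causal past $$\{(x',t'):\ t'<T,\ s_{\max}(t'-T)<x'-x<s_{\min}(t'-T)\}$$ is void (where $s_{\max}$ and $s_{\min}$ are the extreme speeds), and for every $\varepsilon>0$ this causal past contains infinitely many collisions at times in $(T-\varepsilon,T)$. **Euclid's algorithm.** For reals $a>b>0$ let $(a_0,b_0)=(a,b)$, $a_{n+1}=b_n$, $b_{n+1}=a_n \bmod b_n=a_n-\lfloor a_n/b_n\rfloor b_n$. The algorithm halts if $b_n=0$ for some $n$. **Machine $M$.** Meta-signals: $\mathrm{zig},\mathrm{ZIG}$ of speed $1$; $w_0,w_a,w_b$ of speed $0$; $\mathrm{zag},\mathrm{ZAG}$ of speed $-1$. Rules: $\{\mathrm{zig},w_b\}\to\{\mathrm{zag},w_b,\mathrm{ZIG}\}$, $\{w_0,\mathrm{zag}\}\to\{w_0,\mathrm{zig}\}$, $\{w_a,\mathrm{ZIG}\}\to\{\mathrm{ZAG}\}$, $\{w_b,\mathrm{ZAG}\}\to\{\mathrm{ZAG},w_a\}$,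 $\{\mathrm{zig},\mathrm{ZAG}\}\to\{\mathrm{zag},w_b\}$, $\{\mathrm{ZIG},\mathrm{ZAG}\}\to\{\mathrm{ZAG}\}$, $\{\mathrm{zig},w_b,\mathrm{ZAG}\}\to\{\mathrm{ZAG},w_0\}$, $\{w_0,\mathrm{ZAG}\}\to\{w_0\}$; all other collisions leave the signals unchanged. Let $C^{a,b}=\{w_0@0,\ \mathrm{zig}@0,\ w_b@b,\ w_a@a\}$. **Machine $M^\varphi$**, with $\varphi=\frac{1+\sqrt5}2$. It is obtained from $M$ by replacing the speed $1$ by $\varphi$ and adding a meta-signal $\mathrm{start}$ of speed $\varphi$ with the rule $\{\mathrm{start},\mathrm{zag}\}\to\{\mathrm{zag},w_b\}$. $C^{a,b}$ is defined as before. **Statement.** There are 3-speed signal machines with an irrational ratio, either between two initial distances or between two speeds, that produce an accumulation. Precisely: 1. $M$ is a 3-speed machine with speeds $-1,0,1$. For all reals $a>b>0$ with $a/b\notin\mathbb Q$: $C^{a,b}$ is an initial configuration; Euclid's algorithm on $(a,b)$ does not halt; started on $C^{a,b}$, the machine $M$ is for every $n\ge 0$ in the configuration $C^{a_n,b_n}$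 at time $\sum_{i<n}2a_i$; the sum $T=\sum_{n\ge0}2a_n$ is finite; and $M$ produces an accumulation at position $0$ and time $T$. 2. In particular $\varphi/1\notin\mathbb Q$, and $M$ started on $C^{\varphi,1}$ produces an accumulation at position $0$. 3. $M^\varphi$ is a 3-speed machine with speeds $-1,0,\varphi$, and the ratio $\varphi/(-1)$ is irrational. The set $\{w_0@0,\ \mathrm{start}@0,\ \mathrm{zag}@1,\ w_a@1\}$ is an initial configuration with rational positions. Let $(a_n,b_n)$ be the sequence of Euclid's algorithm on $(1,\varphi-1)$ and $\tau=1+\frac1\varphi$. The algorithm does not halt; started on this initial configuration, $M^\varphi$ is for every $n\ge0$ in the configuration $C^{a_n,b_n}$ at time $1+\sum_{i<n}\tau a_i$; the sum $\sum_{n\ge0}\tau a_n$ is finite; and $M^\varphi$ produces an accumulation at position $0$ and time $1+\sum_{n\ge0}\tau a_n$. -/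

import Mathlib

open Filter Topology

noncomputable section

/-- A signal machine with set of meta-signals `S`: a speed for each meta-signal and a collision
function. Sets of at least two meta-signals with pairwise distinct speeds (the sets that can
collide) are mapped to sets of meta-signals with pairwise distinct speeds; the values of `collide`
on other sets are never used. -/
structure SignalMachine (S : Type) [Fintype S] where
  speed : S → ℝ
  collide : Finset S → Finset S
  collide_injOn : ∀ s : Finset S, 2 ≤ s.card → Set.InjOn speed s →
    Set.InjOn speed (collide s : Set S)

namespace SignalMachine

variable {S : Type} [Fintype S]

/-- An `n`-speed machine: the speed function takes exactly `n` values. -/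
def IsNSpeed (M : SignalMachine S) (n : ℕ) : Prop :=
  (Set.range M.speed).ncard = n

/-- A collision rule, given by its set of incoming meta-signals. -/
structure Rule (M : SignalMachine S) where
  incoming : Finset S
  two_le_card : 2 ≤ incoming.card
  injOn : Set.InjOn M.speed (incoming : Set S)

/-- The set of outgoing meta-signals of a collision rule. -/
def Rule.outgoing {M : SignalMachine S} (ρ : M.Rule) : Finset S :=
  M.collide ρ.incoming

/-- What may be found at a position: nothing, an accumulation, a signal, a collision, or (in
initial configurations only) several signals `start s` placed together at the same position. -/
inductive Value (M : SignalMachine S) where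
  | void : Value M
  | accu : Value M
  | signal (μ : S) : Value M
  | collision (ρ : M.Rule) : Value M
  | start (s : Finset S) : Value M

/-- The meta-signals of the signals that leave a position with the given value. -/
def Value.emitted {M : SignalMachine S} : M.Value → Finset S
  | .void => ∅
  | .accu => ∅
  | .signal μ => {μ}
  | .collision ρ => ρ.outgoing
  | .start s => s

/-- The value is a collision. -/
def Value.IsCollision {M : SignalMachine S} (v : M.Value) : Prop :=
  ∃ ρ : M.Rule, v = .collision ρ

/-- Global states: functions from space to values. The laws are in `IsConfiguration`. -/
abbrev Config (M : SignalMachine S) : Type := ℝ → M.Value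

/-- The positions that are not void. -/
def support {M : SignalMachine S} (c : M.Config) : Set ℝ := {x | c x ≠ .void}

/-- Configurations: signals and collisions are isolated, and every accumulation point of the
support is marked as an accumulation. -/
def IsConfiguration (M : SignalMachine S) (c : M.Config) : Prop :=
  (∀ x, c x ≠ .void → c x ≠ .accu → ∃ ε > 0, ∀ y, 0 < |x - y| → |x - y| < ε → c y = .void) ∧
  (∀ x, AccPt x (𝓟 (support c)) → c x = .accu)

/-- Initial configurations: finite support and no accumulation; signals that are placed at the same
position have pairwise distinct speeds. -/
def IsInitial (M : SignalMachine S) (c : M.Config) : Prop :=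
  M.IsConfiguration c ∧ (support c).Finite ∧ (∀ x, c x ≠ .accu) ∧
  (∀ x s, c x = .start s → 2 ≤ s.card ∧ Set.InjOn M.speed (s : Set S))

open Classical in
/-- The configuration `{μ₁@x₁, …, μₖ@xₖ}` for the set `A` of the pairs `(μᵢ, xᵢ)`. -/
def ofSignals (M : SignalMachine S) (A : Set (S × ℝ)) : M.Config := fun x =>
  if h : ∃ μ, (Finset.univ.filter fun ν : S => (ν, x) ∈ A) = {μ} then .signal h.choose
  else if (Finset.univ.filter fun ν : S => (ν, x) ∈ A) = ∅ then .void
  else .start (Finset.univ.filter fun ν : S => (ν, x) ∈ A)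

/-- The reading of `c = {μ₁@x₁, …, μₖ@xₖ}` for an arbitrary configuration: several meta-signals at
the same position stand for any collision that produces them. -/
def Represents {M : SignalMachine S} (c : M.Config) (A : Set (S × ℝ)) : Prop :=
  ∀ x, c x ≠ .accu ∧ ∀ μ, μ ∈ (c x).emitted ↔ (μ, x) ∈ A

/-! ### Dynamics -/

/-- The durations `d > 0` after which two distinct signals of `c`, prolonged as straight lines,
meet. -/
def delays (M : SignalMachine S) (c : M.Config) : Set ℝ :=
  {d | 0 < d ∧ ∃ x₁ x₂ : ℝ, ∃ μ₁ μ₂ : S, x₁ ≠ x₂ ∧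
    μ₁ ∈ (c x₁).emitted ∧ μ₂ ∈ (c x₂).emitted ∧
    x₁ + d * M.speed μ₁ = x₂ + d * M.speed μ₂}

open Classical in
/-- The configuration in which exactly the meta-signals in `A x` arrive at each position `x`:
at least two of them form a collision, a single one is a signal, and then the (static) accumulations
are set. -/
def settle (M : SignalMachine S) (A : ℝ → Finset S) : M.Config := fun x =>
  if h : 2 ≤ (A x).card ∧ Set.InjOn M.speed (A x : Set S) then .collision ⟨A x, h.1, h.2⟩
  else if h : ∃ μ, A x = {μ} then .signal h.choose
  else if AccPt x (𝓟 {y | (A y).Nonempty}) then .accu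
  else .void

open Classical in
/-- The configuration a duration `d > 0` after `c`, for `d` up to and including the time to the
next collision. -/
def advance (M : SignalMachine S) (c : M.Config) (d : ℝ) : M.Config :=
  M.settle fun x => Finset.univ.filter fun μ => μ ∈ (c (x - d * M.speed μ)).emitted

open Classical in
/-- The `n`-th collision time together with the configuration at that time. The time to the next
collision is the minimum of `delays`; the sequence is stationary once there is no further
collision. -/
def stage (M : SignalMachine S) (c₀ : M.Config) : ℕ → ℝ × M.Config
  | 0 => (0, c₀)
  | n + 1 =>
    let p := stage M c₀ n
    if (M.delays p.2).Nonempty then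
      (p.1 + sInf (M.delays p.2), M.advance p.2 (sInf (M.delays p.2)))
    else p

/-- The sequence of collision times. -/
def collisionTime (M : SignalMachine S) (c₀ : M.Config) (n : ℕ) : ℝ := (M.stage c₀ n).1

/-- The configuration at the `n`-th collision time. -/
def collisionConfig (M : SignalMachine S) (c₀ : M.Config) (n : ℕ) : M.Config := (M.stage c₀ n).2

/-- The time `t` lies at or after the `n`-th collision time, and before the next one (if any). -/
def InStage (M : SignalMachine S) (c₀ : M.Config) (n : ℕ) (t : ℝ) : Prop :=
  M.collisionTime c₀ n ≤ t ∧
    ∀ d ∈ M.delays (M.collisionConfig c₀ n), t < M.collisionTime c₀ n + d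

/-- The sequence of collision times is infinite and has the finite limit `T`. -/
def HasLimitTime (M : SignalMachine S) (c₀ : M.Config) (T : ℝ) : Prop :=
  (∀ n, (M.delays (M.collisionConfig c₀ n)).Nonempty) ∧
    Tendsto (M.collisionTime c₀) atTop (𝓝 T)

open Classical in
/-- The configuration at a time `t` before the limit of the collision times (void elsewhere). -/
def configBefore (M : SignalMachine S) (c₀ : M.Config) (t : ℝ) : M.Config :=
  if h : ∃ n, M.InStage c₀ n t then
    if t = M.collisionTime c₀ (Nat.find h) then M.collisionConfig c₀ (Nat.find h)
    else M.advance (M.collisionConfig c₀ (Nat.find h)) (t - M.collisionTime c₀ (Nat.find h))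
  else fun _ => .void

open Classical in
/-- The configuration at the limit `T` of the collision times: first the dynamic accumulations,
where collisions occur arbitrarily close just before `T`; then what the arriving signals produce. -/
def limitConfig (M : SignalMachine S) (c₀ : M.Config) (T : ℝ) : M.Config := fun x =>
  if ∀ ε > 0, ∃ x' t' : ℝ, |x - x'| < ε ∧ T - ε < t' ∧ t' < T ∧
      (M.configBefore c₀ t' x').IsCollision then .accu
  else M.settle (fun y => Finset.univ.filter fun μ : S =>
    ∃ ε > 0, ∀ δ, 0 < δ → δ < ε →
      M.configBefore c₀ (T - δ) (y - δ * M.speed μ) = .signal μ) x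

open Classical in
/-- The space-time diagram generated from `c₀`: the configuration at each time, up to and including
the limit of the collision times when that limit is finite (void at all other times). -/
def diagram (M : SignalMachine S) (c₀ : M.Config) (t : ℝ) : M.Config :=
  if ∃ n, M.InStage c₀ n t then M.configBefore c₀ t
  else if M.HasLimitTime c₀ t then M.limitConfig c₀ t
  else fun _ => .void

/-! ### Accumulations -/

/-- The causal past (backward light cone) of the point at position `x` and time `t`. Points of
space-time are pairs (position, time). -/
def causalPast (M : SignalMachine S) (x t : ℝ) : Set (ℝ × ℝ) :=
  {p | p.2 < t ∧ sSup (Set.range M.speed) * (p.2 - t) < p.1 - x ∧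
    p.1 - x < sInf (Set.range M.speed) * (p.2 - t)}

/-- The topological condition for an accumulation at `(x, t)` in a diagram `D` over the time
interval `[0, t]`: close to `(x, t)` everything outside of its causal past is void, except for
`(x, t)` itself, and there are infinitely many collisions in the causal past arbitrarily shortly
before `t`. -/
def IsIsolatedAccumulation (M : SignalMachine S) (D : ℝ → M.Config) (x t : ℝ) : Prop :=
  (∃ ε > 0, ∀ x' t' : ℝ, (x', t') ∉ M.causalPast x t → (x', t') ≠ (x, t) →
    |x - x'| < ε → |t - t'| < ε → 0 ≤ t' → t' ≤ t → D t' x' = .void) ∧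
  (∀ ε > 0, {p : ℝ × ℝ | p ∈ M.causalPast x t ∧ t - ε < p.2 ∧ p.2 < t ∧
    (D p.2 p.1).IsCollision}.Infinite)

/-- The machine started on `c₀` produces an accumulation at position `x` and time `t`: the
collision times converge to `t`, the diagram has the value `accu` at `(x, t)`, and the topological
condition holds there. -/
def ProducesAccumulationAt (M : SignalMachine S) (c₀ : M.Config) (x t : ℝ) : Prop :=
  M.HasLimitTime c₀ t ∧ M.diagram c₀ t x = .accu ∧ M.IsIsolatedAccumulation (M.diagram c₀) x t

end SignalMachine

/-! ### Euclid's algorithm on real numbers -/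

/-- The pairs `(aₙ, bₙ)` of Euclid's algorithm: `(a₀, b₀) = (a, b)`, `aₙ₊₁ = bₙ` and
`bₙ₊₁ = aₙ mod bₙ`, the remainder of the division of reals with integer quotient. -/
def euclidPair (a b : ℝ) : ℕ → ℝ × ℝ
  | 0 => (a, b)
  | n + 1 =>
    let p := euclidPair a b n
    (p.2, p.1 - ⌊p.1 / p.2⌋ * p.2)

def euclidA (a b : ℝ) (n : ℕ) : ℝ := (euclidPair a b n).1

def euclidB (a b : ℝ) (n : ℕ) : ℝ := (euclidPair a b n).2

/-- Euclid's algorithm halts: some remainder vanishes. -/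
def EuclidHalts (a b : ℝ) : Prop := ∃ n, euclidB a b n = 0

/-! ### The machine with speeds -1, 0, 1 -/

inductive EuclidSignal where
  | zig | bigZig | wall0 | wallA | wallB | zag | bigZag
  deriving DecidableEq

namespace EuclidSignal

instance : Fintype EuclidSignal where
  elems := {zig, bigZig, wall0, wallA, wallB, zag, bigZag}
  complete := by intro μ; cases μ <;> decide

def speed : EuclidSignal → ℝ
  | zig => 1
  | bigZig => 1
  | wall0 => 0
  | wallA => 0
  | wallB => 0
  | zag => -1
  | bigZag => -1

/-- The collision rules; in all other collisions the signals cross unchanged. -/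
def collide (s : Finset EuclidSignal) : Finset EuclidSignal :=
  if s = {zig, wallB} then {zag, wallB, bigZig}
  else if s = {wall0, zag} then {wall0, zig}
  else if s = {wallA, bigZig} then {bigZag}
  else if s = {wallB, bigZag} then {bigZag, wallA}
  else if s = {zig, bigZag} then {zag, wallB}
  else if s = {bigZig, bigZag} then {bigZag}
  else if s = {zig, wallB, bigZag} then {bigZag, wall0}
  else if s = {wall0, bigZag} then {wall0}
  else s

end EuclidSignal

/-- The three-speed machine that runs Euclid's algorithm. -/
def euclidMachine : SignalMachine EuclidSignal where
  speed := EuclidSignal.speed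
  collide := EuclidSignal.collide
  collide_injOn := by
    intro s _ hs
    unfold EuclidSignal.collide
    split_ifs
    all_goals first
      | exact hs
      | (clear hs
         intro μ hμ ν hν h
         simp only [Finset.coe_insert, Finset.coe_singleton, Set.mem_insert_iff,
           Set.mem_singleton_iff] at hμ hν
         first
           | (subst hμ hν; rfl)
           | (rcases hμ with rfl | rfl <;> rcases hν with rfl | rfl <;>
                first | rfl | (norm_num [EuclidSignal.speed] at h; done))
           | (rcases hμ with rfl | rfl | rfl <;> rcases hν with rfl | rfl | rfl <;>
                first | rfl | (norm_num [EuclidSignal.speed] at h; done)))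

/-- The values `a` and `b` encoded as the distances of two walls from the wall at `0`, from which a
signal starts. -/
def euclidSignals (a b : ℝ) : Set (EuclidSignal × ℝ) :=
  {(.wall0, 0), (.zig, 0), (.wallB, b), (.wallA, a)}

/-! ### The machine with speeds -1, 0, φ -/

inductive GoldenSignal where
  | zig | bigZig | init | wall0 | wallA | wallB | zag | bigZag
  deriving DecidableEq

namespace GoldenSignal

instance : Fintype GoldenSignal where
  elems := {zig, bigZig, init, wall0, wallA, wallB, zag, bigZag}
  complete := by intro μ; cases μ <;> decide

def speed : GoldenSignal → ℝ
  | zig => Real.goldenRatio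
  | bigZig => Real.goldenRatio
  | init => Real.goldenRatio
  | wall0 => 0
  | wallA => 0
  | wallB => 0
  | zag => -1
  | bigZag => -1

/-- The collision rules; in all other collisions the signals cross unchanged. -/
def collide (s : Finset GoldenSignal) : Finset GoldenSignal :=
  if s = {init, zag} then {zag, wallB}
  else if s = {zig, wallB} then {zag, wallB, bigZig}
  else if s = {wall0, zag} then {wall0, zig}
  else if s = {wallA, bigZig} then {bigZag}
  else if s = {wallB, bigZag} then {bigZag, wallA}
  else if s = {zig, bigZag} then {zag, wallB}
  else if s = {bigZig, bigZag} then {bigZag}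
  else if s = {zig, wallB, bigZag} then {bigZag, wall0}
  else if s = {wall0, bigZag} then {wall0}
  else s

end GoldenSignal

/-- The three-speed machine that runs Euclid's algorithm with the right speed `φ`. -/
def goldenMachine : SignalMachine GoldenSignal where
  speed := GoldenSignal.speed
  collide := GoldenSignal.collide
  collide_injOn := by
    intro s _ hs
    have h0 := Real.goldenRatio_pos
    unfold GoldenSignal.collide
    split_ifs
    all_goals first
      | exact hs
      | (clear hs
         intro μ hμ ν hν h
         simp only [Finset.coe_insert, Finset.coe_singleton, Set.mem_insert_iff,
           Set.mem_singleton_iff] at hμ hν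
         first
           | (subst hμ hν; rfl)
           | (rcases hμ with rfl | rfl <;> rcases hν with rfl | rfl <;>
                first | rfl | (simp only [GoldenSignal.speed] at h; linarith))
           | (rcases hμ with rfl | rfl | rfl <;> rcases hν with rfl | rfl | rfl <;>
                first | rfl | (simp only [GoldenSignal.speed] at h; linarith)))

/-- The encoding of `a` and `b` for this machine. -/
def goldenSignals (a b : ℝ) : Set (GoldenSignal × ℝ) :=
  {(.wall0, 0), (.zig, 0), (.wallB, b), (.wallA, a)}

/-- The signals of the rational initial configuration. -/
def goldenStart : Set (GoldenSignal × ℝ) :=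
  {(.wall0, 0), (.init, 0), (.zag, 1), (.wallA, 1)}

end

/-! One round of the machine is one division with remainder. Let `v` be the right speed and write
positions as `v * y`, so that a signal leaving 0 needs time `y` to get there and a left-moving one
needs `v * y` to come back. With walls at `v * A` and `v * B`, zig bounces between the walls at 0
and `v * B` with period `(1 + v) * B`, and each hit on the second wall sends a ZIG further along the
line `t = k * ((1 + v) * B) + y`. The first ZIG is turned at `v * A` into a ZAG on the line `t = (1
+ v) * A - v * y`. These lines cross at `y = A - k * B`, whatever `v` is. So the ZAG absorbs the
ZIGs with `0 < k < q`, relabels the wall at `v * B`, and meets zig number `q` at the remainder,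
where it leaves the new wall. The zag released there reaches 0 at time `(1 + v) * A`, and the state
encodes `(B, A - q * B)`. In lengths `a = v * A` the duration is `(1 + 1 / v) * a`.

If `a / b` is irrational, so are all later ratios. Then no remainder vanishes, the inequalities `q *
B < A < (q + 1) * B` are strict, no triple collision occurs, and the divisions never end. From `aₙ₊₂
≤ aₙ - aₙ₊₁` the durations are summable. Every division ends with a collision at 0, and its signals
stay within the backward cone of the limit point, so the accumulation there is isolated. The machine
with speed `φ` first builds the distances `1` and `φ - 1` from rational positions; their ratio is
`φ`.

The formal dynamics is handled by guessing the space-time diagram as finitely many worldlines and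
checking it locally (`IsEvolution`); `IsEvolution.run` shows that the actual run follows such a
diagram. `DividesWith.isEvolution` does the check for one division, for any machine that contains
the signals and rules, and `producesAccumulationAt_of_cone` turns confinement to the cone into an
accumulation. -/

noncomputable section

/-! ### Space-time diagrams made of finitely many worldlines -/

/-- The part of a uniform motion between two instants: at each time `t` from `birth` to `death`, a
signal of speed `s` on this worldline is at position `offset + t * s`. -/
structure Worldline where
  offset : ℝ
  birth : ℝ
  death : ℝ

namespace SignalMachine

variable {S : Type} [Fintype S]

open Classical in
/-- The meta-signals of a family of worldlines that arrive at a point of space-time. -/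
def arriving (M : SignalMachine S) (F : S → Set Worldline) (t x : ℝ) : Finset S :=
  Finset.univ.filter fun μ =>
    ∃ l ∈ F μ, l.birth < t ∧ t ≤ l.death ∧ l.offset + t * M.speed μ = x

open Classical in
/-- The meta-signals of a family of worldlines that depart from a point of space-time. -/
def departing (M : SignalMachine S) (F : S → Set Worldline) (t x : ℝ) : Finset S :=
  Finset.univ.filter fun μ =>
    ∃ l ∈ F μ, l.birth ≤ t ∧ t < l.death ∧ l.offset + t * M.speed μ = x

theorem mem_arriving {M : SignalMachine S} {F : S → Set Worldline} {t x : ℝ} {μ : S} :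
    μ ∈ M.arriving F t x ↔
      ∃ l ∈ F μ, l.birth < t ∧ t ≤ l.death ∧ l.offset + t * M.speed μ = x := by
  simp [arriving]

theorem mem_departing {M : SignalMachine S} {F : S → Set Worldline} {t x : ℝ} {μ : S} :
    μ ∈ M.departing F t x ↔
      ∃ l ∈ F μ, l.birth ≤ t ∧ t < l.death ∧ l.offset + t * M.speed μ = x := by
  simp [departing]

/-- A finite family of worldlines that obeys the collision rules of `M` at all times in `(0, L]`,
with collisions exactly at the points that satisfy `V`. -/
structure IsEvolution (M : SignalMachine S) (F : S → Set Worldline) (L : ℝ)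
    (V : ℝ → ℝ → Prop) : Prop where
  finite : ∀ μ, (F μ).Finite
  birth : ∀ μ, ∀ l ∈ F μ, 0 < l.birth → l.birth ≤ L →
    V l.birth (l.offset + l.birth * M.speed μ)
  death : ∀ μ, ∀ l ∈ F μ, 0 < l.death → l.death ≤ L →
    V l.death (l.offset + l.death * M.speed μ)
  meet : ∀ t x μ ν, 0 < t → t ≤ L → μ ≠ ν → μ ∈ M.arriving F t x → ν ∈ M.arriving F t x → V t x
  two_le_card : ∀ t x, 0 < t → t ≤ L → V t x → 2 ≤ (M.arriving F t x).card
  injOn : ∀ t x, 0 < t → t ≤ L → V t x → Set.InjOn M.speed (M.arriving F t x : Set S)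
  collide : ∀ t x, 0 < t → t ≤ L → V t x →
    M.departing F t x = M.collide (M.arriving F t x)

namespace IsEvolution

variable {M : SignalMachine S} {F : S → Set Worldline} {L : ℝ} {V : ℝ → ℝ → Prop}

/-- At an event two worldlines of different speeds meet; two such lines meet at only one time, and
there are finitely many pairs. -/
theorem finite_eventTimes (h : M.IsEvolution F L V) :
    {t : ℝ | 0 < t ∧ t ≤ L ∧ ∃ x, V t x}.Finite := by
  have hfin : (⋃ μ : S, ⋃ ν : S, Set.image2
      (fun l l' : Worldline => (l'.offset - l.offset) / (M.speed μ - M.speed ν))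
      (F μ) (F ν)).Finite :=
    Set.finite_iUnion fun μ => Set.finite_iUnion fun ν => (h.finite μ).image2 _ (h.finite ν)
  refine hfin.subset ?_
  rintro t ⟨h0, hL, x, hV⟩
  obtain ⟨μ, hμ, ν, hν, hne⟩ := Finset.one_lt_card.1 (h.two_le_card t x h0 hL hV)
  have hs : M.speed μ ≠ M.speed ν := fun e => hne (h.injOn t x h0 hL hV hμ hν e)
  obtain ⟨l, hl, -, -, e⟩ := mem_arriving.1 hμ
  obtain ⟨l', hl', -, -, e'⟩ := mem_arriving.1 hν
  refine Set.mem_iUnion.2 ⟨μ, Set.mem_iUnion.2 ⟨ν, l, hl, l', hl', ?_⟩⟩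
  have : M.speed μ - M.speed ν ≠ 0 := sub_ne_zero.2 hs
  simp only
  field_simp
  linarith

theorem card_le_one (h : M.IsEvolution F L V) {t x : ℝ} (h0 : 0 < t) (hL : t ≤ L)
    (hV : ¬ V t x) : (M.arriving F t x).card ≤ 1 := by
  by_contra! hc
  obtain ⟨μ, hμ, ν, hν, hne⟩ := Finset.one_lt_card.1 hc
  exact hV (h.meet t x μ ν h0 hL hne hμ hν)

/-- The lifetimes `(birth, death]` and `[birth, death)` differ only at their ends, and these are
events. -/
theorem departing_eq (h : M.IsEvolution F L V) {t x : ℝ} (h0 : 0 < t) (hL : t ≤ L)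
    (hV : ¬ V t x) : M.departing F t x = M.arriving F t x := by
  ext μ
  rw [mem_departing, mem_arriving]
  refine exists_congr fun l => and_congr_right fun hl => ⟨?_, ?_⟩
  · rintro ⟨h1, h2, h3⟩
    refine ⟨lt_of_le_of_ne h1 fun e => hV ?_, h2.le, h3⟩
    subst e
    exact h3 ▸ h.birth μ l hl h0 hL
  · rintro ⟨h1, h2, h3⟩
    refine ⟨h1.le, lt_of_le_of_ne h2 fun e => hV ?_, h3⟩
    subst e
    exact h3 ▸ h.death μ l hl h0 hL

theorem finite_support (h : M.IsEvolution F L V) (t : ℝ) :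
    {x | (M.arriving F t x).Nonempty}.Finite := by
  have : (⋃ μ : S, (fun l : Worldline => l.offset + t * M.speed μ) '' F μ).Finite :=
    Set.finite_iUnion fun μ => (h.finite μ).image _
  refine this.subset ?_
  rintro x ⟨μ, hμ⟩
  obtain ⟨l, hl, -, -, e⟩ := mem_arriving.1 hμ
  exact Set.mem_iUnion.2 ⟨μ, l, hl, e⟩

end IsEvolution

theorem not_accPt_of_finite {s : Set ℝ} (hs : s.Finite) (x : ℝ) : ¬ AccPt x (𝓟 s) := by
  intro h
  have := accPt_iff_frequently.1 h
  have hcl : IsClosed (s \ {x}) := (hs.subset Set.sdiff_subset).isClosed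
  refine this ?_
  filter_upwards [hcl.isOpen_compl.mem_nhds (show x ∈ (s \ {x})ᶜ by simp)] with y hy hy'
  exact hy ⟨hy'.2, hy'.1⟩

section Settle

variable {M : SignalMachine S} {A : ℝ → Finset S}

theorem settle_of_two_le {x : ℝ} (h2 : 2 ≤ (A x).card)
    (hi : Set.InjOn M.speed (A x : Set S)) :
    M.settle A x = .collision ⟨A x, h2, hi⟩ := by
  rw [settle, dif_pos ⟨h2, hi⟩]

theorem settle_of_singleton {x : ℝ} {μ : S} (h : A x = {μ}) : M.settle A x = .signal μ := by
  have h2 : ¬ (2 ≤ (A x).card ∧ Set.InjOn M.speed (A x : Set S)) := by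
    rw [h]; simp
  have h1 : ∃ μ, A x = {μ} := ⟨μ, h⟩
  rw [settle, dif_neg h2, dif_pos h1]
  exact congrArg _ (Finset.singleton_injective (h1.choose_spec.symm.trans h))

theorem settle_of_empty {x : ℝ} (h : A x = ∅) (hA : ¬ AccPt x (𝓟 {y | (A y).Nonempty})) :
    M.settle A x = .void := by
  have h2 : ¬ (2 ≤ (A x).card ∧ Set.InjOn M.speed (A x : Set S)) := by
    rw [h]; simp
  have h1 : ¬ ∃ μ, A x = {μ} := by
    rw [h]; rintro ⟨μ, hμ⟩; exact Finset.singleton_ne_empty μ hμ.symm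
  rw [settle, dif_neg h2, dif_neg h1, if_neg hA]

end Settle

namespace IsEvolution

variable {M : SignalMachine S} {F : S → Set Worldline} {L : ℝ} {V : ℝ → ℝ → Prop}

/-- The configuration of an evolution at a positive time. -/
theorem settle_spec (h : M.IsEvolution F L V) {t : ℝ} (h0 : 0 < t) (hL : t ≤ L) (x : ℝ) :
    M.settle (M.arriving F t) x ≠ .accu ∧
      (M.settle (M.arriving F t) x).emitted = M.departing F t x ∧
      (M.settle (M.arriving F t) x ≠ .void → (M.arriving F t x).Nonempty) ∧
      (V t x → (M.settle (M.arriving F t) x).IsCollision) := by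
  by_cases hV : V t x
  · rw [settle_of_two_le (h.two_le_card t x h0 hL hV) (h.injOn t x h0 hL hV)]
    refine ⟨by simp, (h.collide t x h0 hL hV).symm, fun _ => ?_, fun _ => ⟨_, rfl⟩⟩
    exact Finset.card_pos.1 (by have := h.two_le_card t x h0 hL hV; omega)
  · rw [h.departing_eq h0 hL hV]
    rcases (M.arriving F t x).eq_empty_or_nonempty with he | hne
    · rw [settle_of_empty he (not_accPt_of_finite (h.finite_support t) x), he]
      simp [Value.emitted, hV]
    · obtain ⟨μ, hμ⟩ := Finset.card_eq_one.1
        (le_antisymm (h.card_le_one h0 hL hV) hne.card_pos)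
      rw [settle_of_singleton hμ, hμ]
      simp [Value.emitted, hV]

-- Worldlines begin and end only at events, so straight prolongation is correct as long as no event
-- lies strictly in between. An event at time `t + d` itself is allowed, since only arrivals there
-- are compared.
open Classical in
theorem advance_eq (h : M.IsEvolution F L V) {c : M.Config} {t d : ℝ} (h0 : 0 ≤ t) (hd : 0 < d)
    (hL : t + d ≤ L) (hc : ∀ x, (c x).emitted = M.departing F t x)
    (hfree : ∀ s x, t < s → s < t + d → ¬ V s x) :
    (fun x => Finset.univ.filter fun μ => μ ∈ (c (x - d * M.speed μ)).emitted) =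
      M.arriving F (t + d) := by
  funext x
  ext μ
  rw [Finset.mem_filter, hc, mem_departing, mem_arriving]
  simp only [Finset.mem_univ, true_and]
  refine exists_congr fun l => and_congr_right fun hl => ⟨?_, ?_⟩
  · rintro ⟨h1, h2, h3⟩
    refine ⟨by linarith, ?_, by linarith⟩
    by_contra! hlt
    exact hfree _ _ h2 hlt (h.death μ l hl (by linarith) (by linarith))
  · rintro ⟨h1, h2, h3⟩
    refine ⟨?_, by linarith, by linarith⟩
    by_contra! hlt
    exact hfree _ _ hlt h1 (h.birth μ l hl (by linarith) (by linarith))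

/-- Links the abstract events to the dynamics: the first event after `t` is the next collision,
because an earlier meeting of two prolonged signals would be an event by `meet`. -/
theorem isLeast_delays (h : M.IsEvolution F L V) {c : M.Config} {t d x₀ : ℝ} (h0 : 0 ≤ t)
    (hd : 0 < d) (hL : t + d ≤ L) (hc : ∀ x, (c x).emitted = M.departing F t x)
    (hfree : ∀ s x, t < s → s < t + d → ¬ V s x) (hV : V (t + d) x₀) :
    IsLeast (M.delays c) d := by
  classical
  constructor
  · have h2 := h.two_le_card _ _ (by linarith) hL hV
    have hi := h.injOn _ _ (by linarith) hL hV
    rw [← h.advance_eq h0 hd hL hc hfree] at h2 hi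
    obtain ⟨μ, hμ, ν, hν, hne⟩ := Finset.one_lt_card.1 h2
    have hs : M.speed μ ≠ M.speed ν := fun e => hne (hi hμ hν e)
    rw [Finset.mem_filter] at hμ hν
    refine ⟨hd, _, _, μ, ν, fun e => hs ?_, hμ.2, hν.2, by ring⟩
    exact mul_left_cancel₀ hd.ne' (by linarith)
  · rintro d' ⟨hd', x₁, x₂, μ, ν, hx, hμ, hν, e⟩
    by_contra! hlt
    have key := h.advance_eq h0 hd' (by linarith) hc
      (fun s x h1 h2 => hfree s x h1 (by linarith))
    refine hfree (t + d') (x₁ + d' * M.speed μ) (by linarith) (by linarith)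
      (h.meet _ _ μ ν (by linarith) (by linarith) (fun e' => hx ?_) ?_ ?_)
    · subst e'; linarith
    · rw [← key]; simpa using hμ
    · rw [← key, e]; simpa using hν

end IsEvolution

/-! ### The collision times -/

theorem pos_of_mem_delays {M : SignalMachine S} {c : M.Config} {d : ℝ} (h : d ∈ M.delays c) :
    0 < d := h.1

/-- There is a next collision after stage `n`. -/
def IsRegular (M : SignalMachine S) (c₀ : M.Config) (n : ℕ) : Prop :=
  sInf (M.delays (M.collisionConfig c₀ n)) ∈ M.delays (M.collisionConfig c₀ n)

/-- The configuration at time `t`, computed from stage `n`. -/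
def stageConfig (M : SignalMachine S) (c₀ : M.Config) (n : ℕ) (t : ℝ) : M.Config :=
  if t = M.collisionTime c₀ n then M.collisionConfig c₀ n
  else M.advance (M.collisionConfig c₀ n) (t - M.collisionTime c₀ n)

theorem IsRegular.collisionTime_succ {M : SignalMachine S} {c₀ : M.Config} {n : ℕ}
    (h : M.IsRegular c₀ n) : M.collisionTime c₀ (n + 1) =
      M.collisionTime c₀ n + sInf (M.delays (M.collisionConfig c₀ n)) := by
  have : (M.delays (M.stage c₀ n).2).Nonempty := ⟨_, h⟩
  simp only [collisionTime, collisionConfig, stage, if_pos this]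

theorem IsRegular.collisionConfig_succ {M : SignalMachine S} {c₀ : M.Config} {n : ℕ}
    (h : M.IsRegular c₀ n) : M.collisionConfig c₀ (n + 1) =
      M.advance (M.collisionConfig c₀ n) (sInf (M.delays (M.collisionConfig c₀ n))) := by
  have : (M.delays (M.stage c₀ n).2).Nonempty := ⟨_, h⟩
  simp only [collisionConfig, stage, if_pos this]

section Regular

variable {M : SignalMachine S} {c₀ : M.Config}

theorem strictMono_collisionTime (h : ∀ n, M.IsRegular c₀ n) :
    StrictMono (M.collisionTime c₀) :=
  strictMono_nat_of_lt_succ fun n => by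
    rw [(h n).collisionTime_succ]
    exact lt_add_of_pos_right _ (h n).1

theorem InStage.lt_succ {n : ℕ} {t : ℝ} (hn : M.IsRegular c₀ n) (h : M.InStage c₀ n t) :
    t < M.collisionTime c₀ (n + 1) := by
  rw [hn.collisionTime_succ]
  exact h.2 _ hn

theorem InStage.unique (h : ∀ n, M.IsRegular c₀ n) {m n : ℕ} {t : ℝ} (hm : M.InStage c₀ m t)
    (hn : M.InStage c₀ n t) : m = n := by
  have hmono := (strictMono_collisionTime h).monotone
  rcases lt_trichotomy m n with hlt | rfl | hlt
  · exact absurd (hmono (show m + 1 ≤ n from hlt)) (not_le.2 (hn.1.trans_lt (hm.lt_succ (h m))))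
  · rfl
  · exact absurd (hmono (show n + 1 ≤ m from hlt)) (not_le.2 (hm.1.trans_lt (hn.lt_succ (h n))))

/-- Frees later arguments from `Nat.find`: when all stages are regular, at most one stage contains
`t`. -/
theorem configBefore_eq (h : ∀ n, M.IsRegular c₀ n) {n : ℕ} {t : ℝ} (hn : M.InStage c₀ n t) :
    M.configBefore c₀ t = M.stageConfig c₀ n t := by
  classical
  have hex : ∃ n, M.InStage c₀ n t := ⟨n, hn⟩
  have : Nat.find hex = n := InStage.unique h (Nat.find_spec hex) hn
  rw [configBefore, dif_pos hex, stageConfig]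
  simp only [this]

theorem inStage_of_eq {n : ℕ} {t : ℝ} (h : t = M.collisionTime c₀ n) : M.InStage c₀ n t :=
  ⟨h.ge, fun d hd => by have := pos_of_mem_delays hd; linarith⟩

end Regular

namespace IsEvolution

variable {M : SignalMachine S} {F : S → Set Worldline} {L : ℝ} {V : ℝ → ℝ → Prop}

theorem exists_next (h : M.IsEvolution F L V) (hLV : ∃ x, V L x) {t : ℝ} (h0 : 0 ≤ t)
    (ht : t < L) : ∃ d x, 0 < d ∧ t + d ≤ L ∧ V (t + d) x ∧
      ∀ s x, t < s → s < t + d → ¬ V s x := by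
  have hfin : ({s : ℝ | 0 < s ∧ s ≤ L ∧ ∃ x, V s x} ∩ Set.Ioi t).Finite :=
    h.finite_eventTimes.subset Set.inter_subset_left
  obtain ⟨t', ⟨⟨h1, h2, x, h3⟩, h4⟩, hmin⟩ :=
    Set.exists_min_image _ id hfin ⟨L, ⟨by linarith, le_rfl, hLV⟩, ht⟩
  have h4' : t < t' := h4
  refine ⟨t' - t, x, by linarith, by linarith, by simpa using h3, fun s y hs hs' hV => ?_⟩
  have := hmin s ⟨⟨by linarith, by linarith, y, hV⟩, hs⟩
  simp only [id] at this
  linarith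

/-- Induction on the number of event times left after `t`; each collision of the run uses up the
first of them. Since `L` is an event time, the run stops exactly there. -/
theorem run_aux (h : M.IsEvolution F L V) (hLV : ∃ x, V L x) {c₀ : M.Config} {T₀ : ℝ} (k : ℕ) :
    ∀ (t : ℝ) (n : ℕ), 0 ≤ t → t < L →
      ({s : ℝ | 0 < s ∧ s ≤ L ∧ ∃ x, V s x} ∩ Set.Ioi t).ncard ≤ k →
      M.collisionTime c₀ n = T₀ + t →
      (∀ x, (M.collisionConfig c₀ n x).emitted = M.departing F t x) →
      ∃ m, n < m ∧ M.collisionTime c₀ m = T₀ + L ∧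
        M.collisionConfig c₀ m = M.settle (M.arriving F L) ∧
        (∀ i, n ≤ i → i < m → M.IsRegular c₀ i) ∧
        ∀ s, t < s → s ≤ L → ∃ i, M.InStage c₀ i (T₀ + s) ∧
          M.stageConfig c₀ i (T₀ + s) = M.settle (M.arriving F s) := by
  induction k with
  | zero =>
    intro t n h0 ht hk
    exfalso
    have hfin : ({s : ℝ | 0 < s ∧ s ≤ L ∧ ∃ x, V s x} ∩ Set.Ioi t).Finite :=
      h.finite_eventTimes.subset Set.inter_subset_left
    have := (Set.ncard_eq_zero hfin).1 (Nat.le_zero.1 hk)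
    exact this.subset (show L ∈ _ from ⟨⟨by linarith, le_rfl, hLV⟩, ht⟩)
  | succ k ih =>
    intro t n h0 ht hk hT hc
    obtain ⟨d, x₀, hd, hdL, hV, hfree⟩ := h.exists_next hLV h0 ht
    have hleast := h.isLeast_delays h0 hd hdL hc hfree hV
    have hinf : sInf (M.delays (M.collisionConfig c₀ n)) = d := hleast.csInf_eq
    have hreg : M.IsRegular c₀ n := by rw [IsRegular, hinf]; exact hleast.1
    have hT' : M.collisionTime c₀ (n + 1) = T₀ + (t + d) := by
      rw [hreg.collisionTime_succ, hinf, hT, add_assoc]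
    have hadv : ∀ e, 0 < e → e ≤ d →
        M.advance (M.collisionConfig c₀ n) e = M.settle (M.arriving F (t + e)) := by
      intro e he hed
      rw [advance, ← h.advance_eq h0 he (by linarith) hc
        (fun s x h1 h2 => hfree s x h1 (by linarith))]
    have hc' : M.collisionConfig c₀ (n + 1) = M.settle (M.arriving F (t + d)) := by
      rw [hreg.collisionConfig_succ, hinf, hadv d hd le_rfl]
    have hbefore : ∀ s, t < s → s ≤ t + d → ∃ i, M.InStage c₀ i (T₀ + s) ∧
        M.stageConfig c₀ i (T₀ + s) = M.settle (M.arriving F s) := by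
      intro s hs hs'
      rcases hs'.lt_or_eq with hlt | rfl
      · refine ⟨n, ⟨by rw [hT]; linarith, fun e he => ?_⟩, ?_⟩
        · have := hleast.2 he
          rw [hT]; linarith
        · rw [stageConfig, if_neg (by rw [hT]; intro e; linarith), hT,
            hadv _ (by linarith) (by linarith)]
          congr 2; ring
      · exact ⟨n + 1, inStage_of_eq hT'.symm, by rw [stageConfig, if_pos hT'.symm, hc']⟩
    rcases hdL.lt_or_eq with hlt | heq
    · have hcard : ({s : ℝ | 0 < s ∧ s ≤ L ∧ ∃ x, V s x} ∩ Set.Ioi (t + d)).ncard ≤ k := by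
        have hfin : ({s : ℝ | 0 < s ∧ s ≤ L ∧ ∃ x, V s x} ∩ Set.Ioi t).Finite :=
          h.finite_eventTimes.subset Set.inter_subset_left
        have hlt' := Set.ncard_lt_ncard (t := {s : ℝ | 0 < s ∧ s ≤ L ∧ ∃ x, V s x} ∩ Set.Ioi t)
          (s := {s : ℝ | 0 < s ∧ s ≤ L ∧ ∃ x, V s x} ∩ Set.Ioi (t + d))
          ⟨fun s hs => ⟨hs.1, lt_trans (lt_add_of_pos_right t hd) hs.2⟩, fun hsub =>
            lt_irrefl (t + d) (hsub (show t + d ∈ _ from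
              ⟨⟨by linarith, hdL, x₀, hV⟩, lt_add_of_pos_right t hd⟩)).2⟩ hfin
        omega
      obtain ⟨m, hm, h1, h2, h3, h4⟩ := ih (t + d) (n + 1) (by linarith) hlt hcard hT'
        (fun x => by rw [hc']; exact (h.settle_spec (by linarith) hdL x).2.1)
      refine ⟨m, by omega, h1, h2, fun i hi hi' => ?_, fun s hs hs' => ?_⟩
      · rcases hi.lt_or_eq with hi | rfl
        · exact h3 i hi hi'
        · exact hreg
      · rcases le_or_gt s (t + d) with hle | hgt
        · exact hbefore s hs hle
        · exact h4 s hgt hs'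
    · refine ⟨n + 1, by omega, by rw [hT', heq], by rw [hc', heq], fun i hi hi' => ?_,
        fun s hs hs' => hbefore s hs (by linarith)⟩
      obtain rfl : i = n := by omega
      exact hreg

/-- A run that is at the beginning of an evolution follows it. -/
theorem run (h : M.IsEvolution F L V) (hL : 0 < L) (hLV : ∃ x, V L x) {c₀ : M.Config} {T₀ : ℝ}
    {n : ℕ} (hT : M.collisionTime c₀ n = T₀)
    (hc : ∀ x, (M.collisionConfig c₀ n x).emitted = M.departing F 0 x) :
    ∃ m, n < m ∧ M.collisionTime c₀ m = T₀ + L ∧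
      M.collisionConfig c₀ m = M.settle (M.arriving F L) ∧
      (∀ i, n ≤ i → i < m → M.IsRegular c₀ i) ∧
      ∀ s, 0 < s → s ≤ L → ∃ i, M.InStage c₀ i (T₀ + s) ∧
        M.stageConfig c₀ i (T₀ + s) = M.settle (M.arriving F s) :=
  h.run_aux hLV _ 0 n le_rfl hL le_rfl (by rw [hT, add_zero]) hc

end IsEvolution

end SignalMachine

/-! ### The limit of the collision times and a criterion for accumulation -/

namespace SignalMachine

variable {S : Type} [Fintype S] {M : SignalMachine S} {c₀ : M.Config}

theorem collisionTime_zero : M.collisionTime c₀ 0 = 0 := rfl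

theorem lt_limit (h : ∀ n, M.IsRegular c₀ n) {T : ℝ}
    (hT : Tendsto (M.collisionTime c₀) atTop (𝓝 T)) (n : ℕ) : M.collisionTime c₀ n < T :=
  (strictMono_collisionTime h (Nat.lt_succ_self n)).trans_le
    ((strictMono_collisionTime h).monotone.ge_of_tendsto hT _)

theorem not_inStage_limit (h : ∀ n, M.IsRegular c₀ n) {T : ℝ}
    (hT : Tendsto (M.collisionTime c₀) atTop (𝓝 T)) : ¬ ∃ n, M.InStage c₀ n T := by
  rintro ⟨n, hn⟩
  exact lt_asymm (hn.lt_succ (h n)) (lt_limit h hT (n + 1))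

theorem exists_inStage (h : ∀ n, M.IsRegular c₀ n) {T : ℝ}
    (hT : Tendsto (M.collisionTime c₀) atTop (𝓝 T)) {t : ℝ} (h0 : 0 ≤ t) (ht : t < T) :
    ∃ n, M.InStage c₀ n t := by
  classical
  have hex : ∃ n, t < M.collisionTime c₀ n := ((hT.eventually (lt_mem_nhds ht)).exists)
  obtain ⟨n, hn⟩ : ∃ n, Nat.find hex = n + 1 := by
    -- The first collision time beyond `t` is not the initial one, because `0 ≤ t`; the stage before
    -- it contains `t`.
    refine Nat.exists_eq_succ_of_ne_zero fun e => ?_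
    have := Nat.find_spec hex
    rw [e, collisionTime_zero] at this
    linarith
  refine ⟨n, not_lt.1 (Nat.find_min hex (by omega)), fun d hd => ?_⟩
  have h1 := Nat.find_spec hex
  rw [hn, (h n).collisionTime_succ] at h1
  have h2 : sInf (M.delays (M.collisionConfig c₀ n)) ≤ d :=
    csInf_le ⟨0, fun e he => (pos_of_mem_delays he).le⟩ hd
  linarith

theorem diagram_eq_configBefore {t : ℝ} (h : ∃ n, M.InStage c₀ n t) :
    M.diagram c₀ t = M.configBefore c₀ t := by
  rw [diagram, if_pos h]

/-- A crude symmetric cone: the precise slopes do not matter for showing that the diagram shrinks to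
`x₀` at time `T`. -/
theorem abs_le_of_mem_causalPast {x₀ T x t : ℝ} (h : (x, t) ∈ M.causalPast x₀ T) :
    |x - x₀| ≤ (|sSup (Set.range M.speed)| + |sInf (Set.range M.speed)|) * (T - t) := by
  obtain ⟨h1, h2, h3⟩ := h
  simp only at h1 h2 h3
  have h4 : 0 < T - t := by linarith
  have a1 := mul_le_mul_of_nonneg_right (le_abs_self (sSup (Set.range M.speed))) h4.le
  have a2 := mul_le_mul_of_nonneg_right (neg_le_abs (sInf (Set.range M.speed))) h4.le
  have a3 := mul_nonneg (abs_nonneg (sSup (Set.range M.speed))) h4.le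
  have a4 := mul_nonneg (abs_nonneg (sInf (Set.range M.speed))) h4.le
  rw [abs_le]
  constructor <;> linarith

/-- If the diagram is eventually confined to the causal past of `(x₀, T)`, then it is void at the
limit time `T` away from `x₀`. -/
theorem limitConfig_eq_void {x₀ T η : ℝ} (hT0 : 0 < T) (hη : 0 < η)
    (hcone : ∀ t x, 0 ≤ t → T - η < t → t < T → M.configBefore c₀ t x ≠ .void →
      (x, t) ∈ M.causalPast x₀ T) {y : ℝ} (hy : y ≠ x₀) : M.limitConfig c₀ T y = .void := by
  classical
  set K := |sSup (Set.range M.speed)| + |sInf (Set.range M.speed)| with hK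
  have hK0 : 0 ≤ K := by positivity
  have hnear : ∀ t x, 0 ≤ t → T - η < t → t < T → M.configBefore c₀ t x ≠ .void →
      |x - x₀| ≤ K * (T - t) := fun t x h1 h2 h3 h4 =>
    abs_le_of_mem_causalPast (hcone t x h1 h2 h3 h4)
  -- A signal arriving at `y` would be within `K * δ` of `x₀` and within `|M.speed μ| * δ` of `y` at
  -- time `T - δ`. For small `δ` this contradicts `y ≠ x₀`.
  have hempty : ∀ y, y ≠ x₀ → ∀ μ, ¬ ∃ ε > 0, ∀ δ, 0 < δ → δ < ε →
      M.configBefore c₀ (T - δ) (y - δ * M.speed μ) = .signal μ := by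
    rintro y hy μ ⟨ε, hε, hs⟩
    have hr : 0 < |y - x₀| := abs_pos.2 (sub_ne_zero.2 hy)
    have hD : 0 < K + |M.speed μ| + 1 := by positivity
    have hpos : 0 < min (min ε η) (min T (|y - x₀| / (K + |M.speed μ| + 1))) := by positivity
    obtain ⟨δ, hδ0, hδ⟩ := exists_between hpos
    simp only [lt_min_iff] at hδ
    obtain ⟨⟨h1, h2⟩, h3, h4⟩ := hδ
    have hne := hnear (T - δ) (y - δ * M.speed μ) (by linarith) (by linarith) (by linarith)
      (by rw [hs δ hδ0 h1]; simp)
    rw [lt_div_iff₀ hD] at h4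
    have htri : |y - x₀| ≤ |y - δ * M.speed μ - x₀| + |δ * M.speed μ| := by
      have := abs_add_le (y - δ * M.speed μ - x₀) (δ * M.speed μ)
      rwa [show y - δ * M.speed μ - x₀ + δ * M.speed μ = y - x₀ by ring] at this
    rw [abs_mul, abs_of_pos hδ0] at htri
    nlinarith
  rw [limitConfig, if_neg, settle_of_empty]
  · exact Finset.filter_eq_empty_iff.2 fun μ _ => hempty y hy μ
  · refine not_accPt_of_finite ((Set.finite_singleton x₀).subset ?_) y
    rintro z ⟨μ, hμ⟩
    by_contra hz
    exact hempty z hz μ (Finset.mem_filter.1 hμ).2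
  · intro hacc
    have hr : 0 < |y - x₀| := abs_pos.2 (sub_ne_zero.2 hy)
    -- A collision within `ε` of `y` and less than `ε` before `T` gives `|y - x₀| < (K + 1) * ε`;
    -- the radius is chosen to exclude this. The part `min η T` keeps the time where `hcone`
    -- applies.
    obtain ⟨x', t', h1, h2, h3, ρ, h4⟩ := hacc (min (min η T) (|y - x₀| / (K + 1))) (by positivity)
    have h5 : T - t' < min (min η T) (|y - x₀| / (K + 1)) := by linarith
    simp only [lt_min_iff] at h1 h5
    have h6 := hnear t' x' (by linarith) (by linarith) h3 (by rw [h4]; simp)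
    obtain ⟨-, h1⟩ := h1
    obtain ⟨-, h5⟩ := h5
    rw [lt_div_iff₀ (by positivity)] at h1 h5
    have htri := abs_sub_le y x' x₀
    nlinarith [abs_nonneg (y - x')]

/-- A criterion for an isolated accumulation. -/
theorem producesAccumulationAt_of_cone (h : ∀ n, M.IsRegular c₀ n) {x₀ T η : ℝ}
    (hT : Tendsto (M.collisionTime c₀) atTop (𝓝 T)) (hη : 0 < η)
    (hcone : ∀ t x, 0 ≤ t → T - η < t → t < T → M.configBefore c₀ t x ≠ .void →
      (x, t) ∈ M.causalPast x₀ T)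
    {θ : ℕ → ℝ} (hθ : StrictMono θ) (hθT : Tendsto θ atTop (𝓝 T)) (hθ0 : ∀ n, 0 ≤ θ n)
    (hcol : ∀ n, (M.configBefore c₀ (θ n) x₀).IsCollision) :
    M.ProducesAccumulationAt c₀ x₀ T := by
  have hT0 : 0 < T := lt_limit h hT 0
  have hlt : ∀ n, θ n < T := fun n =>
    (hθ (Nat.lt_succ_self n)).trans_le (hθ.monotone.ge_of_tendsto hθT _)
  have hlim : M.HasLimitTime c₀ T := ⟨fun n => ⟨_, h n⟩, hT⟩
  have hdT : M.diagram c₀ T = M.limitConfig c₀ T := by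
    rw [diagram, if_neg (not_inStage_limit h hT), if_pos hlim]
  refine ⟨hlim, ?_, ⟨η, hη, ?_⟩, ?_⟩
  · rw [hdT, limitConfig, if_pos]
    intro ε hε
    obtain ⟨n, hn⟩ := (hθT.eventually (lt_mem_nhds (sub_lt_self T hε))).exists
    exact ⟨x₀, θ n, by simpa using hε, hn, hlt n, hcol n⟩
  · intro x' t' hnot hne _ hd h0 hle
    rcases hle.lt_or_eq with ht | rfl
    · rw [diagram_eq_configBefore (exists_inStage h hT h0 ht)]
      by_contra hv
      exact hnot (hcone t' x' h0 (by linarith [le_abs_self (T - t')]) ht hv)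
    · rw [hdT]
      exact limitConfig_eq_void hT0 hη hcone fun e => hne (by rw [e])
  · intro ε hε
    have hpos : 0 < min ε η := lt_min hε hη
    -- Dropping the first `N` collisions leaves only those late enough both for `ε` and for `hcone`.
    obtain ⟨N, hN⟩ := (hθT.eventually (lt_mem_nhds (sub_lt_self T hpos))).exists
    refine Set.infinite_of_injective_forall_mem (f := fun n => (x₀, θ (n + N))) ?_ ?_
    · intro m n e
      have := hθ.injective (Prod.ext_iff.1 e).2
      omega
    · intro n
      have h1 : T - min ε η < θ (n + N) := hN.trans_le (hθ.monotone (by omega))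
      have h2 := min_le_left ε η
      have h3 := min_le_right ε η
      obtain ⟨ρ, hρ⟩ := hcol (n + N)
      refine ⟨hcone _ _ (hθ0 _) (by linarith) (hlt _) (by rw [hρ]; simp),
        by simp only; linarith, hlt _, ρ, ?_⟩
      rw [diagram_eq_configBefore (exists_inStage h hT (hθ0 _) (hlt _))]
      exact hρ
end SignalMachine

/-! ### One division of Euclid's algorithm

The right speed is `v`, lengths are measured by the time that a right-moving signal needs for them:
the walls are at `v * A` and `v * B`, and the division is `A = q * B + (A - q * B)`. -/

namespace EuclidSignal

/-- The speeds `-1, 0, v`. -/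
def speedWith (v : ℝ) : EuclidSignal → ℝ
  | zig => v
  | bigZig => v
  | wall0 => 0
  | wallA => 0
  | wallB => 0
  | zag => -1
  | bigZag => -1

/-- The worldlines of the signals during one division. -/
def worldlines (v A B : ℝ) (q : ℕ) : EuclidSignal → Set Worldline
  -- The minimum is `B` for `k < q`, when zig hits the wall, and the remainder for `k = q`, when it
  -- meets the ZAG. Deaths at `(1 + v) * A + 1` are placeholders: any time after the end of the
  -- division would do, and the line then still departs at the end.
  | zig => (fun k : ℕ => ⟨-(v * (k * ((1 + v) * B))), k * ((1 + v) * B),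
      k * ((1 + v) * B) + min B (A - k * B)⟩) '' Set.Iic q ∪
      {⟨-(v * ((1 + v) * A)), (1 + v) * A, (1 + v) * A + 1⟩}
  | bigZig => (fun k : ℕ => ⟨-(v * (k * ((1 + v) * B))), k * ((1 + v) * B) + B,
      k * ((1 + v) * B) + (A - k * B)⟩) '' Set.Iio q
  | wall0 => {⟨0, 0, (1 + v) * A + 1⟩}
  | wallA => {⟨v * A, 0, A⟩, ⟨v * B, (1 + v) * A - v * B, (1 + v) * A + 1⟩}
  | wallB => {⟨v * B, 0, (1 + v) * A - v * B⟩,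
      ⟨v * (A - q * B), (1 + v) * A - v * (A - q * B), (1 + v) * A + 1⟩}
  | zag => (fun j : ℕ => ⟨(j + 1) * ((1 + v) * B), (j + 1) * ((1 + v) * B) - v * B,
      (j + 1) * ((1 + v) * B)⟩) '' Set.Iio q ∪
      {⟨(1 + v) * A, (1 + v) * A - v * (A - q * B), (1 + v) * A⟩}
  | bigZag => {⟨(1 + v) * A, A, (1 + v) * A - v * (A - q * B)⟩}

/-- The signals that arrive at time `t` and position `v * y` during one division. -/
def Arrives (v A B : ℝ) (q : ℕ) (t y : ℝ) : EuclidSignal → Prop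
  | zig => ∃ k : ℕ, k ≤ q ∧ 0 < y ∧ y ≤ B ∧ y ≤ A - k * B ∧ t = k * ((1 + v) * B) + y
  | bigZig => ∃ k : ℕ, k < q ∧ B < y ∧ y ≤ A - k * B ∧ t = k * ((1 + v) * B) + y
  | wall0 => y = 0
  | wallA => (y = A ∧ t ≤ A) ∨ (y = B ∧ (1 + v) * A - v * B < t)
  | wallB => (y = B ∧ t ≤ (1 + v) * A - v * B) ∨
      (y = A - q * B ∧ (1 + v) * A - v * (A - q * B) < t)
  | zag => (∃ j : ℕ, j < q ∧ 0 ≤ y ∧ y < B ∧ t = (j + 1) * ((1 + v) * B) - v * y) ∨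
      (0 ≤ y ∧ y < A - q * B ∧ t = (1 + v) * A - v * y)
  | bigZag => A - q * B ≤ y ∧ y < A ∧ t = (1 + v) * A - v * y

/-- The signals that depart at time `t` from position `v * y` during one division. -/
def Departs (v A B : ℝ) (q : ℕ) (t y : ℝ) : EuclidSignal → Prop
  | zig => (∃ k : ℕ, k ≤ q ∧ 0 ≤ y ∧ y < B ∧ y < A - k * B ∧ t = k * ((1 + v) * B) + y) ∨
      (y = 0 ∧ t = (1 + v) * A)
  | bigZig => ∃ k : ℕ, k < q ∧ B ≤ y ∧ y < A - k * B ∧ t = k * ((1 + v) * B) + y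
  | wall0 => y = 0
  | wallA => (y = A ∧ t < A) ∨ (y = B ∧ (1 + v) * A - v * B ≤ t)
  | wallB => (y = B ∧ t < (1 + v) * A - v * B) ∨
      (y = A - q * B ∧ (1 + v) * A - v * (A - q * B) ≤ t)
  | zag => (∃ j : ℕ, j < q ∧ 0 < y ∧ y ≤ B ∧ t = (j + 1) * ((1 + v) * B) - v * y) ∨
      (0 < y ∧ y ≤ A - q * B ∧ t = (1 + v) * A - v * y)
  | bigZag => A - q * B < y ∧ y ≤ A ∧ t = (1 + v) * A - v * y

/-- `Collides v A B q P Q t y`: during one division, the collision `P → Q` takes place at time `t`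
and position `v * y`. -/
inductive Collides (v A B : ℝ) (q : ℕ) :
    Finset EuclidSignal → Finset EuclidSignal → ℝ → ℝ → Prop
  | subtract (k : ℕ) (hk : k < q) :
      Collides v A B q {zig, wallB} {zag, wallB, bigZig} (k * ((1 + v) * B) + B) B
  | bounce (k : ℕ) (h1 : 1 ≤ k) (hk : k ≤ q) :
      Collides v A B q {wall0, zag} {wall0, zig} (k * ((1 + v) * B)) 0
  | restart : Collides v A B q {wall0, zag} {wall0, zig} ((1 + v) * A) 0
  | turn : Collides v A B q {wallA, bigZig} {bigZag} A A
  | relabel : Collides v A B q {wallB, bigZag} {bigZag, wallA} ((1 + v) * A - v * B) B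
  | remainder : Collides v A B q {zig, bigZag} {zag, wallB}
      ((1 + v) * A - v * (A - q * B)) (A - q * B)
  | absorb (k : ℕ) (h1 : 1 ≤ k) (hk : k < q) :
      Collides v A B q {bigZig, bigZag} {bigZag} ((1 + v) * A - v * (A - k * B)) (A - k * B)

/-- `q` is the quotient of `A` by `B`, and the remainder is not zero. -/
structure IsQuotient (A B : ℝ) (q : ℕ) : Prop where
  pos : 0 < B
  one_le : 1 ≤ q
  lt : q * B < A
  gt : A < (q + 1) * B

section Geometry

variable {v A B : ℝ} {q : ℕ}

theorem IsQuotient.mul_le (h : IsQuotient A B q) {k : ℕ} (hk : k ≤ q) : (k : ℝ) * B ≤ q * B :=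
  mul_le_mul_of_nonneg_right (by exact_mod_cast hk) h.pos.le

theorem IsQuotient.succ_mul_le (h : IsQuotient A B q) {k : ℕ} (hk : k < q) :
    ((k : ℝ) + 1) * B ≤ q * B :=
  mul_le_mul_of_nonneg_right (by exact_mod_cast hk) h.pos.le

theorem IsQuotient.le_mul (h : IsQuotient A B q) : B ≤ q * B := by
  simpa using h.mul_le h.one_le

theorem IsQuotient.le_of_lt (h : IsQuotient A B q) {k : ℕ} (hk : (k : ℝ) * B < A) : k ≤ q := by
  by_contra! hlt
  have : ((q : ℝ) + 1) * B ≤ k * B :=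
    mul_le_mul_of_nonneg_right (by exact_mod_cast hlt) h.pos.le
  linarith [h.gt]

/-- Here and in `meet_bigZag` the common factor `1 + v` cancels; this is why the crossing points do
not depend on the speed. -/
theorem meet_zag (hv : 0 < v) {k j : ℕ} {y : ℝ}
    (e : (k : ℝ) * ((1 + v) * B) + y = (j + 1) * ((1 + v) * B) - v * y) :
    y = (j + 1 - k) * B :=
  mul_left_cancel₀ (show 1 + v ≠ 0 by positivity) (by linarith)

theorem meet_bigZag (hv : 0 < v) {k : ℕ} {y : ℝ}
    (e : (k : ℝ) * ((1 + v) * B) + y = (1 + v) * A - v * y) : y = A - k * B :=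
  mul_left_cancel₀ (show 1 + v ≠ 0 by positivity) (by linarith)

theorem false_of_between (hB : 0 < B) {k j : ℕ} (h0 : 0 < ((j : ℝ) + 1 - k) * B)
    (h1 : ((j : ℝ) + 1 - k) * B < B) : False := by
  have h2 : (0 : ℝ) < j + 1 - k := pos_of_mul_pos_left h0 hB.le
  have h3 : (j : ℝ) + 1 - k < 1 := by
    by_contra! h
    have := mul_le_mul_of_nonneg_right h hB.le
    linarith
  have h4 : k < j + 1 := by exact_mod_cast (by linarith : (k : ℝ) < j + 1)
  have h5 : j < k := by exact_mod_cast (by linarith : (j : ℝ) < k)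
  omega

/-- Two different signals meet only in one of the collisions. -/
theorem exists_collides_of_lt (hv : 0 < v) (h : IsQuotient A B q) {t y : ℝ} {σ τ : EuclidSignal}
    (hlt : σ.ctorIdx < τ.ctorIdx)
    (hσ : Arrives v A B q t y σ) (hτ : Arrives v A B q t y τ) :
    ∃ P Q, Collides v A B q P Q t y := by
  have hB := h.pos
  have hAl := h.lt
  have hAg := h.gt
  have hqB := h.le_mul
  have hvA := mul_lt_mul_of_pos_left hAl hv
  have hvB := mul_pos hv hB
  -- The order on constructors leaves 21 unordered pairs.
  cases σ <;> cases τ <;> first | exact absurd hlt (by decide) | skip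
  case zig.bigZig =>
    obtain ⟨k, hk, h1, h2, h3, rfl⟩ := hσ
    obtain ⟨k', hk', h1', h2', -⟩ := hτ
    linarith
  case zig.wall0 =>
    obtain ⟨k, hk, h1, h2, h3, rfl⟩ := hσ
    exact absurd hτ h1.ne'
  case zig.wallA =>
    obtain ⟨k, hk, h1, h2, h3, rfl⟩ := hσ
    rcases hτ with ⟨rfl, h4⟩ | ⟨rfl, h4⟩
    · linarith
    · have := mul_le_mul_of_nonneg_left h3 hv.le
      linarith
  case zig.wallB =>
    obtain ⟨k, hk, h1, h2, h3, rfl⟩ := hσ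
    rcases hτ with ⟨rfl, h4⟩ | ⟨rfl, h4⟩
    · refine ⟨_, _, .subtract k ?_⟩
      have := h.le_of_lt (k := k)
      refine lt_of_le_of_ne hk fun e => ?_
      subst e
      linarith
    · have := h.mul_le hk
      have := mul_le_mul_of_nonneg_left this hv.le
      linarith
  case zig.zag =>
    obtain ⟨k, hk, h1, h2, h3, rfl⟩ := hσ
    rcases hτ with ⟨j, hj, h4, h5, e⟩ | ⟨h4, h5, e⟩
    · have := meet_zag hv e
      subst this
      -- The lines cross only at integer multiples of `B`, and none lies strictly between 0 and `B`.
      exact (false_of_between hB h1 h5).elim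
    · have := meet_bigZag hv e
      have := h.mul_le hk
      linarith
  case zig.bigZag =>
    obtain ⟨k, hk, h1, h2, h3, rfl⟩ := hσ
    obtain ⟨h4, h5, e⟩ := hτ
    have hy := meet_bigZag hv e
    rw [e]
    -- For `k < q` the crossing point `A - k * B` lies beyond `B`, where zig does not go.
    obtain rfl : k = q := by
      refine hk.lt_or_eq.resolve_left fun hlt => ?_
      have := h.succ_mul_le hlt
      linarith
    subst hy
    exact ⟨_, _, .remainder⟩
  case bigZig.wall0 =>
    obtain ⟨k, hk, h1, h2, rfl⟩ := hσ
    have : y = 0 := hτ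
    linarith
  case bigZig.wallA =>
    obtain ⟨k, hk, h1, h2, rfl⟩ := hσ
    rcases hτ with ⟨rfl, h4⟩ | ⟨rfl, h4⟩
    -- Only the ZIG of round 0 gets as far as `A`; the later ones are absorbed on the way.
    · have : (k : ℝ) * B ≤ 0 := by linarith
      have hk0 : (k : ℝ) ≤ 0 := nonpos_of_mul_nonpos_left this hB
      obtain rfl : k = 0 := by exact_mod_cast le_antisymm hk0 k.cast_nonneg
      simpa using ⟨_, _, Collides.turn (v := v) (A := y) (B := B) (q := q)⟩
    · linarith
  case bigZig.wallB =>
    obtain ⟨k, hk, h1, h2, rfl⟩ := hσ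
    rcases hτ with ⟨rfl, h4⟩ | ⟨rfl, h4⟩ <;> linarith
  case bigZig.zag =>
    obtain ⟨k, hk, h1, h2, rfl⟩ := hσ
    rcases hτ with ⟨j, hj, h4, h5, e⟩ | ⟨h4, h5, e⟩ <;> linarith
  case bigZig.bigZag =>
    obtain ⟨k, hk, h1, h2, rfl⟩ := hσ
    obtain ⟨h4, h5, e⟩ := hτ
    have hy := meet_bigZag hv e
    rw [e]
    subst hy
    refine ⟨_, _, .absorb k (Nat.one_le_iff_ne_zero.2 ?_) hk⟩
    rintro rfl
    simp at h5
  case wall0.wallA =>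
    have : y = 0 := hσ
    rcases hτ with ⟨rfl, h4⟩ | ⟨rfl, h4⟩ <;> linarith
  case wall0.wallB =>
    have : y = 0 := hσ
    rcases hτ with ⟨rfl, h4⟩ | ⟨rfl, h4⟩ <;> linarith
  case wall0.zag =>
    obtain rfl : y = 0 := hσ
    rcases hτ with ⟨j, hj, h4, h5, rfl⟩ | ⟨h4, h5, rfl⟩
    · have := Collides.bounce (v := v) (A := A) (B := B) (q := q) (j + 1) (by omega) (by omega)
      push_cast at this
      simpa using ⟨_, _, this⟩
    · simpa using ⟨_, _, Collides.restart (v := v) (A := A) (B := B) (q := q)⟩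
  case wall0.bigZag =>
    obtain rfl : y = 0 := hσ
    linarith [hτ.1]
  case wallA.wallB =>
    rcases hσ with ⟨rfl, h4⟩ | ⟨rfl, h4⟩ <;> rcases hτ with ⟨h5, h6⟩ | ⟨h5, h6⟩ <;> linarith
  case wallA.zag =>
    rcases hσ with ⟨rfl, h1⟩ | ⟨rfl, h1⟩ <;>
      rcases hτ with ⟨j, hj, h4, h5, e⟩ | ⟨h4, h5, e⟩ <;> linarith
  case wallA.bigZag =>
    obtain ⟨h4, h5, e⟩ := hτ
    rcases hσ with ⟨rfl, h1⟩ | ⟨rfl, h1⟩ <;> linarith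
  case wallB.zag =>
    rcases hσ with ⟨rfl, h1⟩ | ⟨rfl, h1⟩ <;>
      rcases hτ with ⟨j, hj, h4, h5, e⟩ | ⟨h4, h5, e⟩ <;> try linarith
    have h6 := h.succ_mul_le hj
    have := mul_le_mul_of_nonneg_left h6 hv.le
    linarith
  case wallB.bigZag =>
    obtain ⟨h4, h5, rfl⟩ := hτ
    rcases hσ with ⟨rfl, h1⟩ | ⟨rfl, h1⟩
    · exact ⟨_, _, .relabel⟩
    · linarith
  case zag.bigZag =>
    obtain ⟨h4, h5, rfl⟩ := hτ
    rcases hσ with ⟨j, hj, h6, h7, e⟩ | ⟨h6, h7, e⟩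
    -- Both signals move left on parallel lines, and the ZAG is strictly later because `(j + 1) * B
    -- ≤ q * B < A`.
    · have h6 := h.succ_mul_le hj
      have := mul_le_mul_of_nonneg_left h6 hv.le
      linarith
    · linarith

end Geometry

end EuclidSignal

/-! ### Exact inputs and outputs of the collisions of one division -/

namespace EuclidSignal

section Geometry

variable {v A B : ℝ} {q : ℕ}

/-- Together with the next three lemmas: at each listed collision the incoming set is exactly `P`
and the outgoing set exactly `Q`, so the rule that fires is the intended one. The strict
inequalities of `IsQuotient` exclude a third incoming signal. -/
theorem Collides.mem_of_arrives (hv : 0 < v) (h : IsQuotient A B q) {t y : ℝ}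
    {P Q : Finset EuclidSignal} (hc : Collides v A B q P Q t y) {σ : EuclidSignal}
    (hσ : Arrives v A B q t y σ) : σ ∈ P := by
  have hB := h.pos
  have hAl := h.lt
  have hAg := h.gt
  have hqB := h.le_mul
  have hvA := mul_lt_mul_of_pos_left hAl hv
  have hvB := mul_pos hv hB
  cases hc with
  | subtract k hk =>
    have hkq := h.succ_mul_le hk
    have hvk := mul_le_mul_of_nonneg_left hkq hv.le
    cases σ <;> first | exact (by decide) | exfalso
    case bigZig => obtain ⟨k', hk', h1, -⟩ := hσ; exact lt_irrefl _ h1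
    case wall0 => exact hB.ne' hσ
    case wallA => rcases hσ with ⟨h1, h2⟩ | ⟨h1, h2⟩ <;> linarith
    case zag => rcases hσ with ⟨j, hj, h1, h2, h3⟩ | ⟨h1, h2, h3⟩ <;> linarith
    case bigZag => obtain ⟨h1, h2, h3⟩ := hσ; linarith
  | bounce k h1 hk =>
    cases σ <;> first | exact (by decide) | exfalso
    case zig => obtain ⟨k', hk', h1, -⟩ := hσ; exact lt_irrefl _ h1
    case bigZig => obtain ⟨k', hk', h1, -⟩ := hσ; linarith
    case wallA => rcases hσ with ⟨h1, h2⟩ | ⟨h1, h2⟩ <;> linarith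
    case wallB => rcases hσ with ⟨h1, h2⟩ | ⟨h1, h2⟩ <;> linarith
    case bigZag => obtain ⟨h1, h2, h3⟩ := hσ; linarith
  | restart =>
    cases σ <;> first | exact (by decide) | exfalso
    case zig => obtain ⟨k', hk', h1, -⟩ := hσ; exact lt_irrefl _ h1
    case bigZig => obtain ⟨k', hk', h1, -⟩ := hσ; linarith
    case wallA => rcases hσ with ⟨h1, h2⟩ | ⟨h1, h2⟩ <;> linarith
    case wallB => rcases hσ with ⟨h1, h2⟩ | ⟨h1, h2⟩ <;> linarith
    case bigZag => obtain ⟨h1, h2, h3⟩ := hσ; linarith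
  | turn =>
    cases σ <;> first | exact (by decide) | exfalso
    case zig => obtain ⟨k', hk', h1, h2, -⟩ := hσ; linarith
    case wall0 => have : A = 0 := hσ; linarith
    case wallB => rcases hσ with ⟨h1, h2⟩ | ⟨h1, h2⟩ <;> linarith
    case zag => rcases hσ with ⟨j, hj, h1, h2, h3⟩ | ⟨h1, h2, h3⟩ <;> linarith
    case bigZag => exact lt_irrefl _ hσ.2.1
  | relabel =>
    cases σ <;> first | exact (by decide) | exfalso
    case zig =>
      obtain ⟨k, hk, h1, h2, h3, h4⟩ := hσ
      have := meet_bigZag hv h4.symm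
      rcases hk.lt_or_eq with hk | rfl
      · linarith [h.succ_mul_le hk]
      · linarith
    case bigZig => obtain ⟨k', hk', h1, -⟩ := hσ; exact lt_irrefl _ h1
    case wall0 => exact hB.ne' hσ
    case wallA => rcases hσ with ⟨h1, h2⟩ | ⟨h1, h2⟩ <;> linarith
    case zag => rcases hσ with ⟨j, hj, h1, h2, h3⟩ | ⟨h1, h2, h3⟩ <;> linarith
  | remainder =>
    cases σ <;> first | exact (by decide) | exfalso
    case bigZig => obtain ⟨k', hk', h1, -⟩ := hσ; linarith
    case wall0 => have : A - q * B = 0 := hσ; linarith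
    case wallA => rcases hσ with ⟨h1, h2⟩ | ⟨h1, h2⟩ <;> linarith
    case wallB => rcases hσ with ⟨h1, h2⟩ | ⟨h1, h2⟩ <;> linarith
    case zag =>
      rcases hσ with ⟨j, hj, h1, h2, h3⟩ | ⟨h1, h2, h3⟩
      · have := h.succ_mul_le hj
        have := mul_le_mul_of_nonneg_left this hv.le
        linarith
      · linarith
  | absorb k h1 hk =>
    have hkq := h.succ_mul_le hk
    have hk1 : B ≤ k * B := le_mul_of_one_le_left hB.le (by exact_mod_cast h1)
    cases σ <;> first | exact (by decide) | exfalso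
    case zig => obtain ⟨k', hk', h1, h2, -⟩ := hσ; linarith
    case wall0 => have : A - k * B = 0 := hσ; linarith
    case wallA => rcases hσ with ⟨h1, h2⟩ | ⟨h1, h2⟩ <;> linarith
    case wallB => rcases hσ with ⟨h1, h2⟩ | ⟨h1, h2⟩ <;> linarith
    case zag => rcases hσ with ⟨j, hj, h1, h2, h3⟩ | ⟨h1, h2, h3⟩ <;> linarith

theorem Collides.arrives_of_mem (hv : 0 < v) (h : IsQuotient A B q) {t y : ℝ}
    {P Q : Finset EuclidSignal} (hc : Collides v A B q P Q t y) {σ : EuclidSignal}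
    (hσ : σ ∈ P) : Arrives v A B q t y σ := by
  have hB := h.pos
  have hAl := h.lt
  have hAg := h.gt
  have hqB := h.le_mul
  have hvA := mul_lt_mul_of_pos_left hAl hv
  have hvB := mul_pos hv hB
  cases hc with
  | subtract k hk =>
    have hkq := h.succ_mul_le hk
    have hvk := mul_le_mul_of_nonneg_left hkq hv.le
    simp only [Finset.mem_insert, Finset.mem_singleton] at hσ
    rcases hσ with rfl | rfl
    · exact ⟨k, hk.le, hB, le_rfl, by linarith, rfl⟩
    · exact Or.inl ⟨rfl, by linarith⟩
  | bounce k h1 hk =>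
    simp only [Finset.mem_insert, Finset.mem_singleton] at hσ
    rcases hσ with rfl | rfl
    · exact rfl
    · obtain ⟨j, rfl⟩ := Nat.exists_eq_add_of_le' h1
      exact Or.inl ⟨j, by omega, le_rfl, hB, by push_cast; ring⟩
  | restart =>
    simp only [Finset.mem_insert, Finset.mem_singleton] at hσ
    rcases hσ with rfl | rfl
    · exact rfl
    · exact Or.inr ⟨le_rfl, by linarith, by ring⟩
  | turn =>
    simp only [Finset.mem_insert, Finset.mem_singleton] at hσ
    rcases hσ with rfl | rfl
    · exact Or.inl ⟨rfl, le_rfl⟩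
    · exact ⟨0, h.one_le, by linarith, by simp, by simp⟩
  | relabel =>
    simp only [Finset.mem_insert, Finset.mem_singleton] at hσ
    rcases hσ with rfl | rfl
    · exact Or.inl ⟨rfl, le_rfl⟩
    · exact ⟨by linarith, by linarith, rfl⟩
  | remainder =>
    simp only [Finset.mem_insert, Finset.mem_singleton] at hσ
    rcases hσ with rfl | rfl
    · exact ⟨q, le_rfl, by linarith, by linarith, le_rfl, by ring⟩
    · exact ⟨le_rfl, by linarith, rfl⟩
  | absorb k h1 hk =>
    have hkq := h.succ_mul_le hk
    have hk1 : B ≤ k * B := le_mul_of_one_le_left hB.le (by exact_mod_cast h1)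
    simp only [Finset.mem_insert, Finset.mem_singleton] at hσ
    rcases hσ with rfl | rfl
    · exact ⟨k, hk, by linarith, le_rfl, by ring⟩
    · exact ⟨by linarith, by linarith, rfl⟩

theorem Collides.mem_of_departs (hv : 0 < v) (h : IsQuotient A B q) {t y : ℝ}
    {P Q : Finset EuclidSignal} (hc : Collides v A B q P Q t y) {σ : EuclidSignal}
    (hσ : Departs v A B q t y σ) : σ ∈ Q := by
  have hB := h.pos
  have hAl := h.lt
  have hAg := h.gt
  have hqB := h.le_mul
  have hvA := mul_lt_mul_of_pos_left hAl hv
  have hvB := mul_pos hv hB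
  cases hc with
  | subtract k hk =>
    have hkq := h.succ_mul_le hk
    have hvk := mul_le_mul_of_nonneg_left hkq hv.le
    cases σ <;> first | exact (by decide) | exfalso
    case zig => rcases hσ with ⟨k', hk', h1, h2, -⟩ | ⟨h1, -⟩ <;> linarith
    case wall0 => exact hB.ne' hσ
    case wallA => rcases hσ with ⟨h1, h2⟩ | ⟨h1, h2⟩ <;> linarith
    case bigZag => obtain ⟨h1, h2, h3⟩ := hσ; linarith
  | bounce k h1 hk =>
    cases σ <;> first | exact (by decide) | exfalso
    case bigZig => obtain ⟨k', hk', h1, -⟩ := hσ; linarith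
    case wallA => rcases hσ with ⟨h1, h2⟩ | ⟨h1, h2⟩ <;> linarith
    case wallB => rcases hσ with ⟨h1, h2⟩ | ⟨h1, h2⟩ <;> linarith
    case zag => rcases hσ with ⟨j, hj, h1, h2, h3⟩ | ⟨h1, h2, h3⟩ <;> linarith
    case bigZag => obtain ⟨h1, h2, h3⟩ := hσ; linarith
  | restart =>
    cases σ <;> first | exact (by decide) | exfalso
    case bigZig => obtain ⟨k', hk', h1, -⟩ := hσ; linarith
    case wallA => rcases hσ with ⟨h1, h2⟩ | ⟨h1, h2⟩ <;> linarith
    case wallB => rcases hσ with ⟨h1, h2⟩ | ⟨h1, h2⟩ <;> linarith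
    case zag => rcases hσ with ⟨j, hj, h1, h2, h3⟩ | ⟨h1, h2, h3⟩ <;> linarith
    case bigZag => obtain ⟨h1, h2, h3⟩ := hσ; linarith
  | turn =>
    cases σ <;> first | exact (by decide) | exfalso
    case zig => rcases hσ with ⟨k', hk', h1, h2, -⟩ | ⟨h1, -⟩ <;> linarith
    case bigZig =>
      obtain ⟨k', hk', h1, h2, -⟩ := hσ
      have : 0 ≤ (k' : ℝ) * B := by positivity
      linarith
    case wall0 => have : A = 0 := hσ; linarith
    case wallA => rcases hσ with ⟨h1, h2⟩ | ⟨h1, h2⟩ <;> linarith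
    case wallB => rcases hσ with ⟨h1, h2⟩ | ⟨h1, h2⟩ <;> linarith
    case zag => rcases hσ with ⟨j, hj, h1, h2, h3⟩ | ⟨h1, h2, h3⟩ <;> linarith
  | relabel =>
    cases σ <;> first | exact (by decide) | exfalso
    case zig => rcases hσ with ⟨k', hk', h1, h2, -⟩ | ⟨h1, -⟩ <;> linarith
    case bigZig =>
      obtain ⟨k', hk', h1, h2, h3⟩ := hσ
      have := meet_bigZag hv h3.symm
      linarith
    case wall0 => exact hB.ne' hσ
    case wallB => rcases hσ with ⟨h1, h2⟩ | ⟨h1, h2⟩ <;> linarith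
    case zag =>
      rcases hσ with ⟨j, hj, h1, h2, h3⟩ | ⟨h1, h2, h3⟩
      · have := h.succ_mul_le hj
        have := mul_le_mul_of_nonneg_left this hv.le
        linarith
      · linarith
  | remainder =>
    cases σ <;> first | exact (by decide) | exfalso
    case zig =>
      rcases hσ with ⟨k', hk', h1, h2, h3, h4⟩ | ⟨h1, -⟩
      · have := meet_bigZag hv h4.symm
        linarith
      · linarith
    case bigZig => obtain ⟨k', hk', h1, -⟩ := hσ; linarith
    case wall0 => have : A - q * B = 0 := hσ; linarith
    case wallA => rcases hσ with ⟨h1, h2⟩ | ⟨h1, h2⟩ <;> linarith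
    case bigZag => exact lt_irrefl _ hσ.1
  | absorb k h1 hk =>
    have hkq := h.succ_mul_le hk
    have hk1 : B ≤ k * B := le_mul_of_one_le_left hB.le (by exact_mod_cast h1)
    cases σ <;> first | exact (by decide) | exfalso
    case zig => rcases hσ with ⟨k', hk', h1, h2, -⟩ | ⟨h1, -⟩ <;> linarith
    case bigZig =>
      obtain ⟨k', hk', h1, h2, h3⟩ := hσ
      have := meet_bigZag hv h3.symm
      linarith
    case wall0 => have : A - k * B = 0 := hσ; linarith
    case wallA => rcases hσ with ⟨h1, h2⟩ | ⟨h1, h2⟩ <;> linarith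
    case wallB => rcases hσ with ⟨h1, h2⟩ | ⟨h1, h2⟩ <;> linarith
    case zag => rcases hσ with ⟨j, hj, h1, h2, h3⟩ | ⟨h1, h2, h3⟩ <;> linarith

theorem Collides.departs_of_mem (hv : 0 < v) (h : IsQuotient A B q) {t y : ℝ}
    {P Q : Finset EuclidSignal} (hc : Collides v A B q P Q t y) {σ : EuclidSignal}
    (hσ : σ ∈ Q) : Departs v A B q t y σ := by
  have hB := h.pos
  have hAl := h.lt
  have hAg := h.gt
  have hqB := h.le_mul
  have hvA := mul_lt_mul_of_pos_left hAl hv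
  have hvB := mul_pos hv hB
  cases hc with
  | subtract k hk =>
    have hkq := h.succ_mul_le hk
    have hvk := mul_le_mul_of_nonneg_left hkq hv.le
    simp only [Finset.mem_insert, Finset.mem_singleton] at hσ
    rcases hσ with rfl | rfl | rfl
    · exact Or.inl ⟨k, hk, hB, le_rfl, by ring⟩
    · exact Or.inl ⟨rfl, by linarith⟩
    · exact ⟨k, hk, le_rfl, by linarith, rfl⟩
  | bounce k h1 hk =>
    have hkq := h.mul_le hk
    simp only [Finset.mem_insert, Finset.mem_singleton] at hσ
    rcases hσ with rfl | rfl
    · exact rfl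
    · exact Or.inl ⟨k, hk, le_rfl, hB, by linarith, by ring⟩
  | restart =>
    simp only [Finset.mem_insert, Finset.mem_singleton] at hσ
    rcases hσ with rfl | rfl
    · exact rfl
    · exact Or.inr ⟨rfl, rfl⟩
  | turn =>
    obtain rfl := Finset.mem_singleton.1 hσ
    exact ⟨by linarith, le_rfl, by ring⟩
  | relabel =>
    simp only [Finset.mem_insert, Finset.mem_singleton] at hσ
    rcases hσ with rfl | rfl
    · exact ⟨by linarith, by linarith, rfl⟩
    · exact Or.inr ⟨rfl, le_rfl⟩
  | remainder =>
    simp only [Finset.mem_insert, Finset.mem_singleton] at hσ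
    rcases hσ with rfl | rfl
    · exact Or.inr ⟨by linarith, le_rfl, rfl⟩
    · exact Or.inr ⟨rfl, le_rfl⟩
  | absorb k h1 hk =>
    have hkq := h.succ_mul_le hk
    have hk1 : B ≤ k * B := le_mul_of_one_le_left hB.le (by exact_mod_cast h1)
    obtain rfl := Finset.mem_singleton.1 hσ
    exact ⟨by linarith, by linarith, rfl⟩

theorem Collides.congr_time {P Q : Finset EuclidSignal} {t t' y : ℝ}
    (hc : Collides v A B q P Q t y) (e : t' = t) : Collides v A B q P Q t' y :=
  e ▸ hc

/-! ### Worldlines and arrivals -/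

/-- Solving each worldline for `y` once and for all reduces the case analyses of the collisions to
linear arithmetic. The bound on `t` removes the final zig, born at `(1 + v) * A`, and the
placeholder deaths. -/
theorem exists_mem_worldlines_arriving (hv : 0 < v) {t y : ℝ}
    (ht : t ≤ (1 + v) * A) (ht0 : 0 < t) (σ : EuclidSignal) :
    (∃ l ∈ worldlines v A B q σ, l.birth < t ∧ t ≤ l.death ∧
      l.offset + t * speedWith v σ = v * y) ↔ Arrives v A B q t y σ := by
  have hlt : ∀ {x z : ℝ}, v * x < v * z → x < z := fun h => lt_of_mul_lt_mul_left h hv.le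
  have hle : ∀ {x z : ℝ}, v * x ≤ v * z → x ≤ z := fun h => le_of_mul_le_mul_left h hv
  have mlt : ∀ {x z : ℝ}, x < z → v * x < v * z := fun h => mul_lt_mul_of_pos_left h hv
  have mle : ∀ {x z : ℝ}, x ≤ z → v * x ≤ v * z := fun h => mul_le_mul_of_nonneg_left h hv.le
  have heq : ∀ {x z : ℝ}, v * x = v * z → x = z := fun h => mul_left_cancel₀ hv.ne' h
  cases σ <;> simp only [worldlines, speedWith, Arrives]
  case zig =>
    constructor
    · rintro ⟨l, ⟨k, hk, rfl⟩ | rfl, h1, h2, h3⟩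
      · obtain rfl : y = t - k * ((1 + v) * B) := heq (by linarith)
        have := min_le_left B (A - k * B)
        have := min_le_right B (A - k * B)
        exact ⟨k, hk, by linarith, by linarith, by linarith, by ring⟩
      · linarith
    · rintro ⟨k, hk, h1, h2, h3, rfl⟩
      exact ⟨_, Or.inl ⟨k, hk, rfl⟩, by linarith, by linarith [le_min h2 h3], by ring⟩
  case bigZig =>
    constructor
    · rintro ⟨l, ⟨k, hk, rfl⟩, h1, h2, h3⟩
      obtain rfl : y = t - k * ((1 + v) * B) := heq (by linarith)
      exact ⟨k, hk, by linarith, by linarith, by ring⟩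
    · rintro ⟨k, hk, h1, h2, rfl⟩
      exact ⟨_, ⟨k, hk, rfl⟩, by linarith, by linarith, by ring⟩
  case wall0 =>
    constructor
    · rintro ⟨l, rfl, h1, h2, h3⟩
      exact heq (by linarith)
    · rintro rfl
      exact ⟨_, rfl, ht0, by linarith, by ring⟩
  case wallA =>
    constructor
    · rintro ⟨l, rfl | rfl, h1, h2, h3⟩
      · exact Or.inl ⟨heq (by linarith), h2⟩
      · exact Or.inr ⟨heq (by linarith), h1⟩
    · rintro (⟨rfl, h1⟩ | ⟨rfl, h1⟩)
      · exact ⟨_, Or.inl rfl, ht0, h1, by ring⟩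
      · exact ⟨_, Or.inr rfl, h1, by linarith, by ring⟩
  case wallB =>
    constructor
    · rintro ⟨l, rfl | rfl, h1, h2, h3⟩
      · exact Or.inl ⟨heq (by linarith), h2⟩
      · exact Or.inr ⟨heq (by linarith), h1⟩
    · rintro (⟨rfl, h1⟩ | ⟨rfl, h1⟩)
      · exact ⟨_, Or.inl rfl, ht0, h1, by ring⟩
      · exact ⟨_, Or.inr rfl, h1, by linarith, by ring⟩
  case zag =>
    constructor
    · rintro ⟨l, ⟨j, hj, rfl⟩ | rfl, h1, h2, h3⟩
      · exact Or.inl ⟨j, hj, hle (by linarith), hlt (by linarith), by linarith⟩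
      · exact Or.inr ⟨hle (by linarith), hlt (by linarith), by linarith⟩
    · rintro (⟨j, hj, h1, h2, rfl⟩ | ⟨h1, h2, rfl⟩)
      · exact ⟨_, Or.inl ⟨j, hj, rfl⟩, by linarith [mlt h2], by linarith [mle h1], by ring⟩
      · exact ⟨_, Or.inr rfl, by linarith [mlt h2], by linarith [mle h1], by ring⟩
  case bigZag =>
    constructor
    · rintro ⟨l, rfl, h1, h2, h3⟩
      exact ⟨hle (by linarith), hlt (by linarith), by linarith⟩
    · rintro ⟨h1, h2, rfl⟩
      exact ⟨_, rfl, by linarith [mlt h2], by linarith [mle h1], by ring⟩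

theorem exists_mem_worldlines_departing (hv : 0 < v) {t y : ℝ}
    (ht : t ≤ (1 + v) * A) (ht0 : 0 ≤ t) (σ : EuclidSignal) :
    (∃ l ∈ worldlines v A B q σ, l.birth ≤ t ∧ t < l.death ∧
      l.offset + t * speedWith v σ = v * y) ↔ Departs v A B q t y σ := by
  have hlt : ∀ {x z : ℝ}, v * x < v * z → x < z := fun h => lt_of_mul_lt_mul_left h hv.le
  have hle : ∀ {x z : ℝ}, v * x ≤ v * z → x ≤ z := fun h => le_of_mul_le_mul_left h hv
  have mlt : ∀ {x z : ℝ}, x < z → v * x < v * z := fun h => mul_lt_mul_of_pos_left h hv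
  have mle : ∀ {x z : ℝ}, x ≤ z → v * x ≤ v * z := fun h => mul_le_mul_of_nonneg_left h hv.le
  have heq : ∀ {x z : ℝ}, v * x = v * z → x = z := fun h => mul_left_cancel₀ hv.ne' h
  cases σ <;> simp only [worldlines, speedWith, Departs]
  case zig =>
    constructor
    · rintro ⟨l, ⟨k, hk, rfl⟩ | rfl, h1, h2, h3⟩
      · obtain rfl : y = t - k * ((1 + v) * B) := heq (by linarith)
        have := min_le_left B (A - k * B)
        have := min_le_right B (A - k * B)
        exact Or.inl ⟨k, hk, by linarith, by linarith, by linarith, by ring⟩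
      · obtain rfl := le_antisymm ht h1
        exact Or.inr ⟨heq (by linarith), rfl⟩
    · rintro (⟨k, hk, h1, h2, h3, rfl⟩ | ⟨rfl, rfl⟩)
      · exact ⟨_, Or.inl ⟨k, hk, rfl⟩, by linarith, by linarith [lt_min h2 h3], by ring⟩
      · exact ⟨_, Or.inr rfl, le_rfl, by linarith, by ring⟩
  case bigZig =>
    constructor
    · rintro ⟨l, ⟨k, hk, rfl⟩, h1, h2, h3⟩
      obtain rfl : y = t - k * ((1 + v) * B) := heq (by linarith)
      exact ⟨k, hk, by linarith, by linarith, by ring⟩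
    · rintro ⟨k, hk, h1, h2, rfl⟩
      exact ⟨_, ⟨k, hk, rfl⟩, by linarith, by linarith, by ring⟩
  case wall0 =>
    constructor
    · rintro ⟨l, rfl, h1, h2, h3⟩
      exact heq (by linarith)
    · rintro rfl
      exact ⟨_, rfl, ht0, by linarith, by ring⟩
  case wallA =>
    constructor
    · rintro ⟨l, rfl | rfl, h1, h2, h3⟩
      · exact Or.inl ⟨heq (by linarith), h2⟩
      · exact Or.inr ⟨heq (by linarith), h1⟩
    · rintro (⟨rfl, h1⟩ | ⟨rfl, h1⟩)
      · exact ⟨_, Or.inl rfl, ht0, h1, by ring⟩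
      · exact ⟨_, Or.inr rfl, h1, by linarith, by ring⟩
  case wallB =>
    constructor
    · rintro ⟨l, rfl | rfl, h1, h2, h3⟩
      · exact Or.inl ⟨heq (by linarith), h2⟩
      · exact Or.inr ⟨heq (by linarith), h1⟩
    · rintro (⟨rfl, h1⟩ | ⟨rfl, h1⟩)
      · exact ⟨_, Or.inl rfl, ht0, h1, by ring⟩
      · exact ⟨_, Or.inr rfl, h1, by linarith, by ring⟩
  case zag =>
    constructor
    · rintro ⟨l, ⟨j, hj, rfl⟩ | rfl, h1, h2, h3⟩
      · exact Or.inl ⟨j, hj, hlt (by linarith), hle (by linarith), by linarith⟩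
      · exact Or.inr ⟨hlt (by linarith), hle (by linarith), by linarith⟩
    · rintro (⟨j, hj, h1, h2, rfl⟩ | ⟨h1, h2, rfl⟩)
      · exact ⟨_, Or.inl ⟨j, hj, rfl⟩, by linarith [mle h2], by linarith [mlt h1], by ring⟩
      · exact ⟨_, Or.inr rfl, by linarith [mle h2], by linarith [mlt h1], by ring⟩
  case bigZag =>
    constructor
    · rintro ⟨l, rfl, h1, h2, h3⟩
      exact ⟨hlt (by linarith), hle (by linarith), by linarith⟩
    · rintro ⟨h1, h2, rfl⟩
      exact ⟨_, rfl, by linarith [mle h2], by linarith [mlt h1], by ring⟩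

/-- A positive birth excludes the four signals present at the start, among them zig number 0. -/
theorem collides_of_birth {σ : EuclidSignal} {l : Worldline}
    (hl : l ∈ worldlines v A B q σ) (h0 : 0 < l.birth) :
    ∃ P Q y, l.offset + l.birth * speedWith v σ = v * y ∧ Collides v A B q P Q l.birth y := by
  cases σ <;> simp only [worldlines] at hl
  case zig =>
    rcases hl with ⟨k, hk, rfl⟩ | rfl
    · refine ⟨_, _, 0, by simp only [speedWith]; ring, .bounce k ?_ hk⟩
      refine Nat.one_le_iff_ne_zero.2 ?_
      rintro rfl
      simp at h0
    · exact ⟨_, _, 0, by simp only [speedWith]; ring, .restart⟩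
  case bigZig =>
    obtain ⟨k, hk, rfl⟩ := hl
    exact ⟨_, _, B, by simp only [speedWith]; ring, .subtract k hk⟩
  case wall0 =>
    subst hl
    exact absurd h0 (lt_irrefl _)
  case wallA =>
    rcases hl with rfl | rfl
    · exact absurd h0 (lt_irrefl _)
    · exact ⟨_, _, B, by simp only [speedWith]; ring, .relabel⟩
  case wallB =>
    rcases hl with rfl | rfl
    · exact absurd h0 (lt_irrefl _)
    · exact ⟨_, _, A - q * B, by simp only [speedWith]; ring, .remainder⟩
  case zag =>
    rcases hl with ⟨j, hj, rfl⟩ | rfl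
    · exact ⟨_, _, B, by simp only [speedWith]; ring,
          Collides.congr_time (.subtract j hj) (by ring)⟩
    · exact ⟨_, _, A - q * B, by simp only [speedWith]; ring, .remainder⟩
  case bigZag =>
    subst hl
    exact ⟨_, _, A, by simp only [speedWith]; ring, .turn⟩

/-- The bound on the death excludes the lines that survive the division. -/
theorem collides_of_death (h : IsQuotient A B q) {σ : EuclidSignal} {l : Worldline}
    (hl : l ∈ worldlines v A B q σ) (h1 : l.death ≤ (1 + v) * A) :
    ∃ P Q y, l.offset + l.death * speedWith v σ = v * y ∧ Collides v A B q P Q l.death y := by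
  have hAg := h.gt
  cases σ <;> simp only [worldlines] at hl
  case zig =>
    rcases hl with ⟨k, hk, rfl⟩ | rfl
    · rcases (show k ≤ q from hk).lt_or_eq with hk | rfl
      · have := h.succ_mul_le hk
        have := h.lt
        simp only [min_eq_left (show B ≤ A - k * B by linarith)]
        exact ⟨_, _, B, by simp only [speedWith]; ring, .subtract k hk⟩
      · simp only [min_eq_right (show A - k * B ≤ B by linarith)]
        exact ⟨_, _, A - k * B, by simp only [speedWith]; ring,
          Collides.congr_time .remainder (by ring)⟩
    · simp only at h1; linarith
  case bigZig =>
    obtain ⟨k, hk, rfl⟩ := hl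
    rcases k.eq_zero_or_pos with rfl | h0
    · exact ⟨_, _, A, by simp only [speedWith]; push_cast; ring,
          Collides.congr_time .turn (by push_cast; ring)⟩
    · exact ⟨_, _, A - k * B, by simp only [speedWith]; ring,
          Collides.congr_time (.absorb k h0 hk) (by ring)⟩
  case wall0 =>
    subst hl
    simp only at h1; linarith
  case wallA =>
    rcases hl with rfl | rfl
    · exact ⟨_, _, A, by simp only [speedWith]; ring, .turn⟩
    · simp only at h1; linarith
  case wallB =>
    rcases hl with rfl | rfl
    · exact ⟨_, _, B, by simp only [speedWith]; ring, .relabel⟩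
    · simp only at h1; linarith
  case zag =>
    rcases hl with ⟨j, hj, rfl⟩ | rfl
    · exact ⟨_, _, 0, by simp only [speedWith]; ring,
          Collides.congr_time (.bounce (j + 1) (by omega) (show j + 1 ≤ q from hj)) (by push_cast; ring)⟩
    · exact ⟨_, _, 0, by simp only [speedWith]; ring, .restart⟩
  case bigZag =>
    subst hl
    exact ⟨_, _, A - q * B, by simp only [speedWith]; ring, .remainder⟩

end Geometry

end EuclidSignal

/-! ### Rules in use, the two ends of a division, and confinement to a cone -/

namespace EuclidSignal

/-- The rules that are used in a division with a remainder that is not zero. -/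
inductive DivisionRule : Finset EuclidSignal → Finset EuclidSignal → Prop
  | subtract : DivisionRule {zig, wallB} {zag, wallB, bigZig}
  | bounce : DivisionRule {wall0, zag} {wall0, zig}
  | turn : DivisionRule {wallA, bigZig} {bigZag}
  | relabel : DivisionRule {wallB, bigZag} {bigZag, wallA}
  | remainder : DivisionRule {zig, bigZag} {zag, wallB}
  | absorb : DivisionRule {bigZig, bigZag} {bigZag}

theorem Collides.divisionRule {v A B : ℝ} {q : ℕ} {P Q : Finset EuclidSignal} {t y : ℝ}
    (h : Collides v A B q P Q t y) : DivisionRule P Q := by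
  cases h <;> constructor

theorem DivisionRule.two_le_card {P Q : Finset EuclidSignal} (h : DivisionRule P Q) :
    2 ≤ P.card := by
  cases h <;> decide

theorem DivisionRule.injOn {P Q : Finset EuclidSignal} (h : DivisionRule P Q) {v : ℝ}
    (hv : 0 < v) : Set.InjOn (speedWith v) (P : Set EuclidSignal) := by
  have h1 : v ≠ -1 := by linarith
  have h2 : -1 ≠ v := h1.symm
  cases h <;> intro σ hσ τ hτ e <;>
    simp only [Finset.coe_insert, Finset.coe_singleton, Set.mem_insert_iff,
      Set.mem_singleton_iff] at hσ hτ <;>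
    rcases hσ with rfl | rfl <;> rcases hτ with rfl | rfl <;>
    first | rfl | simp [speedWith, hv.ne', hv.ne, h1, h2] at e

section Start

variable {v A B : ℝ} {q : ℕ}

theorem departs_zero_iff (hv : 0 < v) (h : IsQuotient A B q) {y : ℝ} {σ : EuclidSignal} :
    Departs v A B q 0 y σ ↔ (σ, y) ∈
      ({(wall0, 0), (zig, 0), (wallB, B), (wallA, A)} : Set (EuclidSignal × ℝ)) := by
  have hB := h.pos
  have hAl := h.lt
  have hqB := h.le_mul
  have hvA := mul_lt_mul_of_pos_left hAl hv
  have hvqB := mul_le_mul_of_nonneg_left hqB hv.le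
  have hvB := mul_pos hv hB
  simp only [Set.mem_insert_iff, Set.mem_singleton_iff, Prod.mk.injEq]
  cases σ <;> simp only [Departs, reduceCtorEq, false_and, true_and, false_or, or_false, iff_false]
  case zig =>
    constructor
    · rintro (⟨k, hk, h1, h2, h3, h4⟩ | ⟨h1, h2⟩)
      · have : 0 ≤ (k : ℝ) * ((1 + v) * B) := by positivity
        linarith
      · exact h1
    · rintro rfl
      exact Or.inl ⟨0, Nat.zero_le _, le_rfl, hB, by simp; linarith, by simp⟩
  case bigZig =>
    rintro ⟨k, hk, h1, h2, h3⟩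
    have : 0 ≤ (k : ℝ) * ((1 + v) * B) := by positivity
    linarith
  case wallA =>
    constructor
    · rintro (⟨h1, h2⟩ | ⟨h1, h2⟩)
      · exact h1
      · linarith
    · rintro rfl
      exact Or.inl ⟨rfl, by linarith⟩
  case wallB =>
    constructor
    · rintro (⟨h1, h2⟩ | ⟨h1, h2⟩)
      · exact h1
      · linarith
    · rintro rfl
      exact Or.inl ⟨rfl, by linarith⟩
  case zag =>
    rintro (⟨j, hj, h1, h2, h3⟩ | ⟨h1, h2, h3⟩)
    · have : 0 ≤ (j : ℝ) * ((1 + v) * B) := by positivity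
      have := mul_le_mul_of_nonneg_left h2 hv.le
      linarith
    · have := mul_le_mul_of_nonneg_left h2 hv.le
      linarith
  case bigZag =>
    rintro ⟨h1, h2, h3⟩
    have := mul_le_mul_of_nonneg_left h2 hv.le
    linarith

/-- This makes divisions chain: it has the form of `departs_zero_iff` with `(A, B)` replaced by `(B,
A - q * B)`. -/
theorem departs_end_iff (hv : 0 < v) (h : IsQuotient A B q) {y : ℝ} {σ : EuclidSignal} :
    Departs v A B q ((1 + v) * A) y σ ↔ (σ, y) ∈
      ({(wall0, 0), (zig, 0), (wallB, A - q * B), (wallA, B)} : Set (EuclidSignal × ℝ)) := by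
  have hB := h.pos
  have hAl := h.lt
  have hqB := h.le_mul
  have hvA := mul_lt_mul_of_pos_left hAl hv
  have hvqB := mul_le_mul_of_nonneg_left hqB hv.le
  have hvB := mul_pos hv hB
  simp only [Set.mem_insert_iff, Set.mem_singleton_iff, Prod.mk.injEq]
  cases σ <;> simp only [Departs, reduceCtorEq, false_and, true_and, false_or, or_false, iff_false]
  case zig =>
    constructor
    · rintro (⟨k, hk, h1, h2, h3, h4⟩ | ⟨h1, h2⟩)
      · have := mul_le_mul_of_nonneg_left (h.mul_le hk) hv.le
        linarith
      · exact h1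
    · rintro rfl
      exact Or.inr ⟨rfl, trivial⟩
  case bigZig =>
    rintro ⟨k, hk, h1, h2, h3⟩
    have := mul_le_mul_of_nonneg_left (h.mul_le hk.le) hv.le
    linarith
  case wallA =>
    constructor
    · rintro (⟨h1, h2⟩ | ⟨h1, h2⟩)
      · linarith
      · exact h1
    · rintro rfl
      exact Or.inr ⟨rfl, by linarith⟩
  case wallB =>
    constructor
    · rintro (⟨h1, h2⟩ | ⟨h1, h2⟩)
      · linarith
      · exact h1
    · rintro rfl
      exact Or.inr ⟨rfl, by linarith⟩
  case zag =>
    rintro (⟨j, hj, h1, h2, h3⟩ | ⟨h1, h2, h3⟩)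
    · have h4 := h.succ_mul_le hj
      have := mul_le_mul_of_nonneg_left h4 hv.le
      have := mul_pos hv h1
      linarith
    · have := mul_pos hv h1
      linarith
  case bigZag =>
    rintro ⟨h1, h2, h3⟩
    have := mul_lt_mul_of_pos_left h1 hv
    linarith

/-- All signals are in the causal past of a point that is reached after two further divisions. -/
theorem Arrives.mem_cone (hv : 0 < v) (h : IsQuotient A B q) {t y : ℝ} {σ : EuclidSignal}
    (ht : t ≤ (1 + v) * A) (hσ : Arrives v A B q t y σ) :
    0 ≤ y ∧ v * y < (1 + v) * A + (1 + v) * B - t := by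
  have hB := h.pos
  have hAl := h.lt
  have hAg := h.gt
  have hqB := h.le_mul
  have hvB := mul_pos hv hB
  -- Beyond the wall at `B` every signal is on or to the left of the ZAG line `v * y = (1 + v) * A -
  -- t`; up to `B`, the time of the next division leaves room enough.
  suffices 0 ≤ y ∧ (y ≤ B ∨ v * y ≤ (1 + v) * A - t) by
    refine ⟨this.1, ?_⟩
    rcases this.2 with h1 | h1
    · have := mul_le_mul_of_nonneg_left h1 hv.le
      linarith
    · linarith
  cases σ
  case zig =>
    obtain ⟨k, hk, h1, h2, h3, rfl⟩ := hσ
    exact ⟨h1.le, Or.inl h2⟩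
  case bigZig =>
    obtain ⟨k, hk, h1, h2, rfl⟩ := hσ
    have := mul_le_mul_of_nonneg_left h2 hv.le
    exact ⟨by linarith, Or.inr (by linarith)⟩
  case wall0 =>
    obtain rfl : y = 0 := hσ
    exact ⟨le_rfl, Or.inl hB.le⟩
  case wallA =>
    rcases hσ with ⟨rfl, h1⟩ | ⟨rfl, h1⟩
    · exact ⟨by linarith, Or.inr (by linarith)⟩
    · exact ⟨hB.le, Or.inl le_rfl⟩
  case wallB =>
    rcases hσ with ⟨rfl, h1⟩ | ⟨rfl, h1⟩
    · exact ⟨hB.le, Or.inl le_rfl⟩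
    · exact ⟨by linarith, Or.inl (by linarith)⟩
  case zag =>
    rcases hσ with ⟨j, hj, h1, h2, h3⟩ | ⟨h1, h2, h3⟩
    · exact ⟨h1, Or.inl h2.le⟩
    · exact ⟨h1, Or.inl (by linarith)⟩
  case bigZag =>
    obtain ⟨h1, h2, rfl⟩ := hσ
    exact ⟨by linarith, Or.inr (by linarith)⟩

end Start

theorem finite_worldlines (v A B : ℝ) (q : ℕ) (σ : EuclidSignal) :
    (worldlines v A B q σ).Finite := by
  cases σ <;> simp only [worldlines] <;> exact Set.toFinite _

end EuclidSignal

open EuclidSignal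

/-! ### Transfer of one division to any machine containing the rules -/

namespace SignalMachine

variable {S : Type} [Fintype S] {M : SignalMachine S} {e : EuclidSignal ↪ S} {v : ℝ}

/-- The machine contains the signals and the rules for Euclid's algorithm, with right speed `v`. -/
structure DividesWith (M : SignalMachine S) (e : EuclidSignal ↪ S) (v : ℝ) : Prop where
  pos : 0 < v
  speed : ∀ σ, M.speed (e σ) = speedWith v σ
  collide : ∀ P Q, DivisionRule P Q → M.collide (P.map e) = Q.map e

/-- A family of worldlines for the signals of Euclid's algorithm as a family for a machine that
contains them. -/
def liftWorldlines (e : EuclidSignal ↪ S) (F : EuclidSignal → Set Worldline) :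
    S → Set Worldline :=
  fun μ => {l | ∃ σ, e σ = μ ∧ l ∈ F σ}

/-- The signals `w₀` and `zig` at `0`, `w_b` at `b` and `w_a` at `a`. -/
def encoding (e : EuclidSignal ↪ S) (a b : ℝ) : Set (S × ℝ) :=
  {(e .wall0, 0), (e .zig, 0), (e .wallB, b), (e .wallA, a)}

namespace DividesWith

theorem mem_arriving_iff (hM : M.DividesWith e v) {A B : ℝ} {q : ℕ} {t y : ℝ}
    (h0 : 0 < t) (ht : t ≤ (1 + v) * A) {μ : S} :
    μ ∈ M.arriving (liftWorldlines e (worldlines v A B q)) t (v * y) ↔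
      ∃ σ, e σ = μ ∧ Arrives v A B q t y σ := by
  rw [mem_arriving]
  constructor
  · rintro ⟨l, ⟨σ, rfl, hl⟩, h1, h2, h3⟩
    rw [hM.speed] at h3
    exact ⟨σ, rfl, (exists_mem_worldlines_arriving hM.pos ht h0 σ).1 ⟨l, hl, h1, h2, h3⟩⟩
  · rintro ⟨σ, rfl, hσ⟩
    obtain ⟨l, hl, h⟩ := (exists_mem_worldlines_arriving hM.pos ht h0 σ).2 hσ
    exact ⟨l, ⟨σ, rfl, hl⟩, by rwa [hM.speed]⟩

theorem mem_departing_iff (hM : M.DividesWith e v) {A B : ℝ} {q : ℕ} {t y : ℝ}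
    (h0 : 0 ≤ t) (ht : t ≤ (1 + v) * A) {μ : S} :
    μ ∈ M.departing (liftWorldlines e (worldlines v A B q)) t (v * y) ↔
      ∃ σ, e σ = μ ∧ Departs v A B q t y σ := by
  rw [mem_departing]
  constructor
  · rintro ⟨l, ⟨σ, rfl, hl⟩, h1, h2, h3⟩
    rw [hM.speed] at h3
    exact ⟨σ, rfl, (exists_mem_worldlines_departing hM.pos ht h0 σ).1 ⟨l, hl, h1, h2, h3⟩⟩
  · rintro ⟨σ, rfl, hσ⟩
    obtain ⟨l, hl, h⟩ := (exists_mem_worldlines_departing hM.pos ht h0 σ).2 hσ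
    exact ⟨l, ⟨σ, rfl, hl⟩, by rwa [hM.speed]⟩

theorem mul_div (hM : M.DividesWith e v) (x : ℝ) : v * (x / v) = x :=
  mul_div_cancel₀ x hM.pos.ne'

/-- One division of Euclid's algorithm. -/
theorem isEvolution (hM : M.DividesWith e v) {A B : ℝ} {q : ℕ} (h : IsQuotient A B q) :
    M.IsEvolution (liftWorldlines e (worldlines v A B q)) ((1 + v) * A)
      fun t x => ∃ P Q y, x = v * y ∧ Collides v A B q P Q t y := by
  have key : ∀ t y P Q, 0 < t → t ≤ (1 + v) * A → Collides v A B q P Q t y →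
      M.arriving (liftWorldlines e (worldlines v A B q)) t (v * y) = P.map e := by
    intro t y P Q h0 ht hc
    ext μ
    rw [hM.mem_arriving_iff h0 ht, Finset.mem_map]
    exact ⟨fun ⟨σ, h1, h2⟩ => ⟨σ, hc.mem_of_arrives hM.pos h h2, h1⟩,
      fun ⟨σ, h1, h2⟩ => ⟨σ, h2, hc.arrives_of_mem hM.pos h h1⟩⟩
  refine ⟨?_, ?_, ?_, ?_, ?_, ?_, ?_⟩
  · intro μ
    have : (⋃ σ, worldlines v A B q σ).Finite :=
      Set.finite_iUnion fun σ => finite_worldlines v A B q σ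
    refine this.subset ?_
    rintro l ⟨σ, -, hl⟩
    exact Set.mem_iUnion.2 ⟨σ, hl⟩
  · rintro _ l ⟨σ, rfl, hl⟩ h0 -
    rw [hM.speed]
    exact collides_of_birth hl h0
  · rintro _ l ⟨σ, rfl, hl⟩ - h1
    rw [hM.speed]
    exact collides_of_death h hl h1
  · intro t x μ ν h0 ht hne hμ hν
    rw [← hM.mul_div x, hM.mem_arriving_iff h0 ht] at hμ hν
    obtain ⟨σ, rfl, hσ⟩ := hμ
    obtain ⟨τ, rfl, hτ⟩ := hν
    -- The constructor index is injective, so two different signals can be put in the order that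
    -- `exists_collides_of_lt` expects.
    have hidx : σ.ctorIdx ≠ τ.ctorIdx := fun e' => hne (by
      cases σ <;> cases τ <;> first | rfl | exact absurd e' (by decide))
    rcases hidx.lt_or_gt with hlt | hlt
    · obtain ⟨P, Q, hc⟩ := exists_collides_of_lt hM.pos h hlt hσ hτ
      exact ⟨P, Q, _, (hM.mul_div x).symm, hc⟩
    · obtain ⟨P, Q, hc⟩ := exists_collides_of_lt hM.pos h hlt hτ hσ
      exact ⟨P, Q, _, (hM.mul_div x).symm, hc⟩
  · rintro t _ h0 ht ⟨P, Q, y, rfl, hc⟩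
    rw [key t y P Q h0 ht hc, Finset.card_map]
    exact hc.divisionRule.two_le_card
  · rintro t _ h0 ht ⟨P, Q, y, rfl, hc⟩
    rw [key t y P Q h0 ht hc]
    intro μ hμ ν hν hs
    obtain ⟨σ, hσ, rfl⟩ := Finset.mem_map.1 hμ
    obtain ⟨τ, hτ, rfl⟩ := Finset.mem_map.1 hν
    rw [hM.speed, hM.speed] at hs
    rw [hc.divisionRule.injOn hM.pos hσ hτ hs]
  · rintro t _ h0 ht ⟨P, Q, y, rfl, hc⟩
    rw [key t y P Q h0 ht hc, hM.collide P Q hc.divisionRule]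
    ext μ
    rw [hM.mem_departing_iff h0.le ht, Finset.mem_map]
    exact ⟨fun ⟨σ, h1, h2⟩ => ⟨σ, hc.mem_of_departs hM.pos h h2, h1⟩,
      fun ⟨σ, h1, h2⟩ => ⟨σ, h2, hc.departs_of_mem hM.pos h h1⟩⟩

theorem mem_encoding_iff (hM : M.DividesWith e v) {A B y : ℝ} {μ : S} :
    (μ, v * y) ∈ encoding e (v * A) (v * B) ↔ ∃ σ, e σ = μ ∧ (σ, y) ∈
      ({(wall0, 0), (zig, 0), (wallB, B), (wallA, A)} : Set (EuclidSignal × ℝ)) := by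
  have hv := hM.pos.ne'
  simp only [encoding, Set.mem_insert_iff, Set.mem_singleton_iff, Prod.mk.injEq,
    mul_eq_zero, hv, false_or, mul_right_inj' hv]
  constructor
  · rintro (⟨rfl, rfl⟩ | ⟨rfl, rfl⟩ | ⟨rfl, rfl⟩ | ⟨rfl, rfl⟩) <;> exact ⟨_, rfl, by simp⟩
  · rintro ⟨σ, rfl, ⟨rfl, rfl⟩ | ⟨rfl, rfl⟩ | ⟨rfl, rfl⟩ | ⟨rfl, rfl⟩⟩ <;> simp

theorem departing_zero (hM : M.DividesWith e v) {A B : ℝ} {q : ℕ} (h : IsQuotient A B q)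
    {x : ℝ} {μ : S} : μ ∈ M.departing (liftWorldlines e (worldlines v A B q)) 0 x ↔
      (μ, x) ∈ encoding e (v * A) (v * B) := by
  have hA : 0 ≤ (1 + v) * A := by
    have := hM.pos; have := h.pos; have := h.lt; have := h.le_mul
    have : 0 < A := by linarith
    positivity
  rw [← hM.mul_div x, hM.mem_departing_iff le_rfl hA, hM.mem_encoding_iff]
  simp only [departs_zero_iff hM.pos h]

theorem departing_end (hM : M.DividesWith e v) {A B : ℝ} {q : ℕ} (h : IsQuotient A B q)
    {x : ℝ} {μ : S} :
    μ ∈ M.departing (liftWorldlines e (worldlines v A B q)) ((1 + v) * A) x ↔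
      (μ, x) ∈ encoding e (v * B) (v * (A - q * B)) := by
  have hA : 0 ≤ (1 + v) * A := by
    have := hM.pos; have := h.pos; have := h.lt; have := h.le_mul
    have : 0 < A := by linarith
    positivity
  rw [← hM.mul_div x, hM.mem_departing_iff hA le_rfl, hM.mem_encoding_iff]
  simp only [departs_end_iff hM.pos h]

end DividesWith

end SignalMachine

/-! ### Euclid's algorithm on incommensurate numbers -/

section Euclid

variable {a b : ℝ}

theorem euclidA_zero (a b : ℝ) : euclidA a b 0 = a := rfl

theorem euclidB_zero (a b : ℝ) : euclidB a b 0 = b := rfl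

theorem euclidA_succ (a b : ℝ) (n : ℕ) : euclidA a b (n + 1) = euclidB a b n := rfl

theorem euclidB_succ (a b : ℝ) (n : ℕ) : euclidB a b (n + 1) =
    euclidA a b n - ⌊euclidA a b n / euclidB a b n⌋ * euclidB a b n := rfl

/-- One step sends the ratio `x` to `(Int.fract x)⁻¹`, as in a continued fraction. This stays
irrational, and an irrational fractional part is not 0. -/
theorem euclid_invariant (hb : 0 < b) (hab : b < a) (hirr : Irrational (a / b)) (n : ℕ) :
    0 < euclidB a b n ∧ euclidB a b n < euclidA a b n ∧
      Irrational (euclidA a b n / euclidB a b n) := by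
  induction n with
  | zero => exact ⟨hb, hab, hirr⟩
  | succ n ih =>
    obtain ⟨h1, h2, h3⟩ := ih
    rw [euclidA_succ, euclidB_succ]
    set x := euclidA a b n / euclidB a b n with hx
    have hA : euclidA a b n = x * euclidB a b n := (div_mul_cancel₀ _ h1.ne').symm
    have e : euclidA a b n - ⌊x⌋ * euclidB a b n = Int.fract x * euclidB a b n := by
      rw [Int.fract, sub_mul, ← hA]
    have hf : Irrational (Int.fract x) := h3.sub_intCast _
    have hpos : 0 < Int.fract x := lt_of_le_of_ne (Int.fract_nonneg x) hf.ne_zero.symm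
    rw [e]
    refine ⟨mul_pos hpos h1, mul_lt_of_lt_one_left h1 (Int.fract_lt_one x), ?_⟩
    have : euclidB a b n / (Int.fract x * euclidB a b n) = (Int.fract x)⁻¹ := by
      field_simp
    rw [this]
    exact hf.inv

theorem not_euclidHalts (hb : 0 < b) (hab : b < a) (hirr : Irrational (a / b)) :
    ¬ EuclidHalts a b := by
  rintro ⟨n, hn⟩
  exact (euclid_invariant hb hab hirr n).1.ne' hn

theorem euclidA_pos (hb : 0 < b) (hab : b < a) (hirr : Irrational (a / b)) (n : ℕ) :
    0 < euclidA a b n := by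
  obtain ⟨h1, h2, -⟩ := euclid_invariant hb hab hirr n
  exact h1.trans h2

/-- The quotients of Euclid's algorithm. -/
theorem exists_isQuotient (hb : 0 < b) (hab : b < a) (hirr : Irrational (a / b)) {v : ℝ}
    (hv : 0 < v) (n : ℕ) : ∃ q : ℕ, IsQuotient (euclidA a b n / v) (euclidB a b n / v) q ∧
      euclidB a b (n + 1) = v * (euclidA a b n / v - q * (euclidB a b n / v)) := by
  obtain ⟨h1, h2, h3⟩ := euclid_invariant hb hab hirr n
  obtain ⟨h4, -, -⟩ := euclid_invariant hb hab hirr (n + 1)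
  rw [euclidB_succ] at h4 ⊢
  set x := euclidA a b n / euclidB a b n with hx
  have hA : euclidA a b n = x * euclidB a b n := (div_mul_cancel₀ _ h1.ne').symm
  have hx1 : 1 < x := (one_lt_div h1).2 h2
  -- The algorithm uses the integer floor, the machine counts with naturals; they agree since `1 <
  -- x`.
  have hfl : ((⌊x⌋₊ : ℕ) : ℝ) = ⌊x⌋ := natCast_floor_eq_intCast_floor (by linarith)
  refine ⟨⌊x⌋₊, ⟨by positivity, Nat.le_floor (by simpa using hx1.le), ?_, ?_⟩, ?_⟩
  · rw [mul_div, div_lt_div_iff_of_pos_right hv, hfl]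
    linarith
  · rw [mul_div, div_lt_div_iff_of_pos_right hv, hfl, hA]
    exact mul_lt_mul_of_pos_right (Int.lt_floor_add_one x) h1
  · rw [hfl]
    field_simp

/-- The quotient is at least 1, so each dividend is at least divisor plus remainder. -/
theorem euclidA_add_two_le (hb : 0 < b) (hab : b < a) (hirr : Irrational (a / b)) (n : ℕ) :
    euclidA a b (n + 2) ≤ euclidA a b n - euclidA a b (n + 1) := by
  obtain ⟨q, hq, e⟩ := exists_isQuotient hb hab hirr one_pos n
  have := hq.le_mul
  rw [euclidA_succ, e, euclidA_succ]
  simp only [div_one] at this ⊢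
  linarith

/-- Summing `euclidA_add_two_le` telescopes: the terms from index 2 on have partial sums below `a`.
-/
theorem summable_euclidA (hb : 0 < b) (hab : b < a) (hirr : Irrational (a / b)) :
    Summable (euclidA a b) := by
  rw [← summable_nat_add_iff 2]
  refine summable_of_sum_range_le (c := a) (fun n => (euclidA_pos hb hab hirr _).le) fun n => ?_
  have : ∀ n, ∑ i ∈ Finset.range n, euclidA a b (i + 2) ≤ a - euclidA a b n := by
    intro n
    induction n with
    | zero => simp [euclidA_zero]
    | succ n ih =>
      rw [Finset.sum_range_succ]
      linarith [euclidA_add_two_le hb hab hirr n]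
  linarith [this n, euclidA_pos hb hab hirr n]

end Euclid

/-! ### Infinitely many divisions and their accumulation -/

namespace SignalMachine

variable {S : Type} [Fintype S] {M : SignalMachine S} {e : EuclidSignal ↪ S} {v : ℝ}

/-- The run of `M` on `c₀` is at its `n`-th collision time `T`, all preceding collision times
being defined, and it is in the configuration `{μ₁@x₁, …, μₖ@xₖ}` for the set `A` of the pairs
`(μᵢ, xᵢ)`. -/
structure Reaches (M : SignalMachine S) (c₀ : M.Config) (n : ℕ) (T : ℝ) (A : Set (S × ℝ)) :
    Prop where
  time : M.collisionTime c₀ n = T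
  represents : Represents (M.collisionConfig c₀ n) A
  regular : ∀ i < n, M.IsRegular c₀ i

/-- A run that has reached the beginning of an evolution follows it up to its end. -/
theorem Reaches.run {c₀ : M.Config} {n : ℕ} {T L : ℝ} {A A' : Set (S × ℝ)}
    {F : S → Set Worldline} {V : ℝ → ℝ → Prop} (hr : M.Reaches c₀ n T A)
    (h : M.IsEvolution F L V) (hL : 0 < L) (hV : ∃ x, V L x)
    (h0 : ∀ x μ, μ ∈ M.departing F 0 x ↔ (μ, x) ∈ A)
    (h1 : ∀ x μ, μ ∈ M.departing F L x ↔ (μ, x) ∈ A') :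
    (∃ m, n < m ∧ M.Reaches c₀ m (T + L) A') ∧
      ∀ s, 0 < s → s ≤ L → ∃ i, M.InStage c₀ i (T + s) ∧
        M.stageConfig c₀ i (T + s) = M.settle (M.arriving F s) := by
  obtain ⟨m, hm, hT, hc, hreg, hs⟩ := h.run hL hV hr.time (fun x => by
    ext μ
    rw [(hr.represents x).2 μ, h0])
  refine ⟨⟨m, hm, hT, fun x => ?_, fun i hi => ?_⟩, hs⟩
  · obtain ⟨h2, h3, -⟩ := h.settle_spec hL le_rfl x
    rw [hc]
    refine ⟨h2, fun μ => ?_⟩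
    rw [h3, h1]
  · rcases lt_or_ge i n with hlt | hge
    · exact hr.regular i hlt
    · exact hreg i hge hi

theorem Reaches.diagram {c₀ : M.Config} {n : ℕ} {T : ℝ} {A : Set (S × ℝ)}
    (hr : M.Reaches c₀ n T A) (h : ∀ i, M.IsRegular c₀ i) : Represents (M.diagram c₀ T) A := by
  have hin : M.InStage c₀ n T := inStage_of_eq hr.time.symm
  rw [diagram_eq_configBefore ⟨n, hin⟩, configBefore_eq h hin, stageConfig,
    if_pos hr.time.symm]
  exact hr.represents

/-- The time after `n` divisions of a run that begins Euclid's algorithm at time `T₀`. -/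
def divisionTime (v a b T₀ : ℝ) (n : ℕ) : ℝ :=
  T₀ + ∑ i ∈ Finset.range n, (1 + 1 / v) * euclidA a b i

theorem divisionTime_succ (v a b T₀ : ℝ) (n : ℕ) : divisionTime v a b T₀ (n + 1) =
    divisionTime v a b T₀ n + (1 + 1 / v) * euclidA a b n := by
  rw [divisionTime, divisionTime, Finset.sum_range_succ, add_assoc]

namespace DividesWith

variable {a b : ℝ} {c₀ : M.Config} {n₀ : ℕ} {T₀ : ℝ}

theorem exists_collides_end (v A B : ℝ) (q : ℕ) :
    ∃ P Q y, (0 : ℝ) = v * y ∧ Collides v A B q P Q ((1 + v) * A) y :=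
  ⟨_, _, 0, by simp, .restart⟩

theorem duration_eq (hM : M.DividesWith e v) (x : ℝ) : (1 + v) * (x / v) = (1 + 1 / v) * x := by
  have := hM.pos
  field_simp
  ring

/-- The `n`-th division. -/
theorem division (hM : M.DividesWith e v) (hb : 0 < b) (hab : b < a)
    (hirr : Irrational (a / b)) {n m : ℕ} {T : ℝ}
    (hr : M.Reaches c₀ m T (encoding e (euclidA a b n) (euclidB a b n))) :
    (∃ m', m < m' ∧ M.Reaches c₀ m' (T + (1 + 1 / v) * euclidA a b n)
      (encoding e (euclidA a b (n + 1)) (euclidB a b (n + 1)))) ∧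
    ∀ s, 0 < s → s ≤ (1 + 1 / v) * euclidA a b n → ∃ i c, M.InStage c₀ i (T + s) ∧
      M.stageConfig c₀ i (T + s) = c ∧
      (∀ x, c x ≠ .void → 0 ≤ x ∧
        x < (1 + 1 / v) * euclidA a b n + (1 + 1 / v) * euclidA a b (n + 1) - s) ∧
      (s = (1 + 1 / v) * euclidA a b n → (c 0).IsCollision) := by
  -- Lengths are divided by `v` to pass to the units of `worldlines`; the quotient is unchanged.
  obtain ⟨q, hq, hB⟩ := exists_isQuotient hb hab hirr hM.pos n
  have hevo := hM.isEvolution hq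
  have hv := hM.pos
  have hA := euclidA_pos hb hab hirr n
  have hL : 0 < (1 + v) * (euclidA a b n / v) := by positivity
  obtain ⟨h1, h2⟩ := hr.run hevo hL ⟨0, exists_collides_end _ _ _ _⟩
    (A' := encoding e (euclidA a b (n + 1)) (euclidB a b (n + 1)))
    (fun x μ => by rw [hM.departing_zero hq, hM.mul_div, hM.mul_div])
    (fun x μ => by rw [hM.departing_end hq, hM.mul_div, ← hB, ← euclidA_succ])
  rw [hM.duration_eq] at h1
  refine ⟨h1, fun s h0 hs => ?_⟩
  rw [← hM.duration_eq] at hs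
  obtain ⟨i, hi, hc⟩ := h2 s h0 hs
  refine ⟨i, _, hi, hc, fun x hx => ?_, fun e => ?_⟩
  · obtain ⟨μ, hμ⟩ := (hevo.settle_spec h0 hs x).2.2.1 hx
    rw [← hM.mul_div x, hM.mem_arriving_iff h0 hs] at hμ
    obtain ⟨σ, -, hσ⟩ := hμ
    obtain ⟨h3, h4⟩ := hσ.mem_cone hv hq hs
    rw [hM.mul_div, hM.duration_eq, hM.duration_eq] at h4
    refine ⟨?_, h4⟩
    rw [← hM.mul_div x]
    positivity
  · rw [← hM.duration_eq] at e
    exact (hevo.settle_spec h0 hs 0).2.2.2 (e ▸ exists_collides_end _ _ _ _)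

/-- The bound `n ≤ m` holds because each division contains at least one collision. It yields
regularity of every stage and convergence of all collision times. -/
theorem exists_reaches (hM : M.DividesWith e v) (hb : 0 < b) (hab : b < a)
    (hirr : Irrational (a / b)) (hr : M.Reaches c₀ n₀ T₀ (encoding e a b)) (n : ℕ) :
    ∃ m, n ≤ m ∧ M.Reaches c₀ m (divisionTime v a b T₀ n)
      (encoding e (euclidA a b n) (euclidB a b n)) := by
  induction n with
  | zero => exact ⟨n₀, Nat.zero_le _, by
      simpa only [divisionTime, Finset.range_zero, Finset.sum_empty, add_zero, euclidA_zero,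
        euclidB_zero] using hr⟩
  | succ n ih =>
    obtain ⟨m, hm, hr'⟩ := ih
    obtain ⟨⟨m', hm', hr''⟩, -⟩ := hM.division hb hab hirr hr'
    exact ⟨m', by omega, by rwa [divisionTime_succ]⟩

theorem isRegular (hM : M.DividesWith e v) (hb : 0 < b) (hab : b < a)
    (hirr : Irrational (a / b)) (hr : M.Reaches c₀ n₀ T₀ (encoding e a b)) (i : ℕ) :
    M.IsRegular c₀ i := by
  obtain ⟨m, hm, hr'⟩ := hM.exists_reaches hb hab hirr hr (i + 1)
  exact hr'.regular i hm

theorem represents (hM : M.DividesWith e v) (hb : 0 < b) (hab : b < a)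
    (hirr : Irrational (a / b)) (hr : M.Reaches c₀ n₀ T₀ (encoding e a b)) (n : ℕ) :
    Represents (M.diagram c₀ (divisionTime v a b T₀ n))
      (encoding e (euclidA a b n) (euclidB a b n)) := by
  obtain ⟨m, hm, hr'⟩ := hM.exists_reaches hb hab hirr hr n
  exact hr'.diagram (hM.isRegular hb hab hirr hr)

/-- A run that reaches the encoding of two incommensurate numbers produces an accumulation. -/
theorem producesAccumulationAt (hM : M.DividesWith e v) (hb : 0 < b) (hab : b < a)
    (hirr : Irrational (a / b)) (hr : M.Reaches c₀ n₀ T₀ (encoding e a b)) :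
    ∃ T, HasSum (fun n => (1 + 1 / v) * euclidA a b n) T ∧
      M.ProducesAccumulationAt c₀ 0 (T₀ + T) := by
  have hv := hM.pos
  have hreg := hM.isRegular hb hab hirr hr
  have hmono := strictMono_collisionTime hreg
  have hT₀ : 0 ≤ T₀ := by
    rw [← hr.time, ← collisionTime_zero (M := M) (c₀ := c₀)]
    exact hmono.monotone (Nat.zero_le _)
  obtain ⟨T, hT⟩ := (summable_euclidA hb hab hirr).mul_left (1 + 1 / v)
  refine ⟨T, hT, ?_⟩
  set θ := divisionTime v a b T₀ with hθ
  have hpos : ∀ n, 0 < (1 + 1 / v) * euclidA a b n := fun n => by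
    have := euclidA_pos hb hab hirr n
    positivity
  have hθmono : StrictMono θ := strictMono_nat_of_lt_succ fun n => by
    rw [hθ, divisionTime_succ]
    exact lt_add_of_pos_right _ (hpos n)
  have hθT : Tendsto θ atTop (𝓝 (T₀ + T)) := hT.tendsto_sum_nat.const_add T₀
  have hθle : ∀ n, θ n ≤ T₀ + T := fun n => hθmono.monotone.ge_of_tendsto hθT n
  have hθ0 : θ 0 = T₀ := by simp [hθ, divisionTime]
  have hlim : Tendsto (M.collisionTime c₀) atTop (𝓝 (T₀ + T)) := by
    -- The collision times and the division times interleave: the `i`-th collision time is at most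
    -- `θ i`, and every `θ n` is a collision time.
    refine tendsto_atTop_isLUB hmono.monotone ⟨?_, ?_⟩
    · rintro _ ⟨i, rfl⟩
      obtain ⟨m, hm, hr'⟩ := hM.exists_reaches hb hab hirr hr i
      exact (hmono.monotone hm).trans (hr'.time.trans_le (hθle i))
    · intro u hu
      refine le_of_tendsto' hθT fun n => ?_
      obtain ⟨m, hm, hr'⟩ := hM.exists_reaches hb hab hirr hr n
      have := hu ⟨m, rfl⟩
      rwa [hr'.time] at this
  have hstate : ∀ n s, 0 < s → s ≤ (1 + 1 / v) * euclidA a b n →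
      (∀ x, M.configBefore c₀ (θ n + s) x ≠ .void → 0 ≤ x ∧ x < θ (n + 2) - (θ n + s)) ∧
      (s = (1 + 1 / v) * euclidA a b n →
        (M.configBefore c₀ (θ n + s) 0).IsCollision) := by
    intro n s h0 hs
    obtain ⟨m, hm, hr'⟩ := hM.exists_reaches hb hab hirr hr n
    obtain ⟨i, c, hi, rfl, hx, hcol⟩ := (hM.division hb hab hirr hr').2 s h0 hs
    rw [configBefore_eq hreg hi]
    refine ⟨fun x hne => ?_, hcol⟩
    obtain ⟨h1, h2⟩ := hx x hne
    refine ⟨h1, ?_⟩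
    rw [hθ, divisionTime_succ, divisionTime_succ]
    linarith
  have hsup : 0 < sSup (Set.range M.speed) := by
    refine hv.trans_le (le_csSup (Set.finite_range _).bddAbove ⟨e .zig, ?_⟩)
    rw [hM.speed]; rfl
  have hinf : sInf (Set.range M.speed) ≤ -1 := by
    refine csInf_le (Set.finite_range _).bddBelow ⟨e .zag, ?_⟩
    rw [hM.speed]; rfl
  -- With `η = T` the cone condition concerns the times after `T₀`. The shift skips `θ 0 = T₀`,
  -- where there may be initial signals at 0 instead of a collision.
  refine producesAccumulationAt_of_cone hreg (η := T) (θ := fun n => θ (n + 1)) hlim ?_ ?_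
    (fun m n hmn => hθmono (by omega)) ((tendsto_add_atTop_iff_nat 1).2 hθT) ?_ ?_
  · have := hθmono (Nat.lt_succ_self 0)
    have := hθle 1
    rw [hθ0] at *
    linarith
  · intro t x _ ht htT hne
    classical
    have hex : ∃ n, t ≤ θ n := (hθT.eventually (le_mem_nhds htT)).exists
    obtain ⟨n, hn⟩ : ∃ n, Nat.find hex = n + 1 := by
      refine Nat.exists_eq_succ_of_ne_zero fun e => ?_
      have := Nat.find_spec hex
      rw [e, hθ0] at this
      linarith
    have h1 : θ n < t := not_le.1 (Nat.find_min hex (by omega))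
    have h2 : t ≤ θ n + (1 + 1 / v) * euclidA a b n := by
      rw [hθ, ← divisionTime_succ, ← hθ, ← hn]
      exact Nat.find_spec hex
    obtain ⟨h3, -⟩ := hstate n (t - θ n) (by linarith) (by linarith)
    rw [add_sub_cancel] at h3
    obtain ⟨h4, h5⟩ := h3 x hne
    have h6 := hθle (n + 2)
    refine ⟨htT, ?_, ?_⟩
    -- The left edge of the cone is negative while `0 ≤ x`; the right edge is at least `T₀ + T - t`,
    -- which exceeds `x` as `θ (n + 2) ≤ T₀ + T`.
    · have := mul_neg_of_pos_of_neg hsup (show t - (T₀ + T) < 0 by linarith)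
      simp only
      linarith
    · have := mul_le_mul_of_nonpos_right hinf (show t - (T₀ + T) ≤ 0 by linarith)
      simp only
      linarith
  · intro n
    exact hT₀.trans (hθ0 ▸ hθmono.monotone (Nat.zero_le _))
  · intro n
    have := (hstate n _ (hpos n) le_rfl).2 rfl
    rwa [hθ, ← divisionTime_succ] at this

end DividesWith

end SignalMachine

namespace SignalMachine

variable {S : Type} [Fintype S] (M : SignalMachine S)

/-! ### Initial configurations -/

theorem represents_ofSignals (A : Set (S × ℝ)) : Represents (M.ofSignals A) A := by
  classical
  intro x
  have hmem : ∀ μ, μ ∈ (Finset.univ.filter fun ν : S => (ν, x) ∈ A) ↔ (μ, x) ∈ A := by simp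
  rw [ofSignals]
  split_ifs with h1 h2
  · refine ⟨by simp, fun μ => ?_⟩
    rw [← hmem μ]
    exact (Finset.ext_iff.1 h1.choose_spec μ).symm
  · refine ⟨by simp, fun μ => ?_⟩
    rw [← hmem μ, h2]
    rfl
  · exact ⟨by simp, hmem⟩

theorem exists_mem_of_ofSignals_ne_void {A : Set (S × ℝ)} {x : ℝ}
    (h : M.ofSignals A x ≠ .void) : ∃ μ, (μ, x) ∈ A := by
  classical
  by_contra! hA
  have he : (Finset.univ.filter fun ν : S => (ν, x) ∈ A) = ∅ := by simp [hA]
  refine h ?_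
  rw [ofSignals, dif_neg, if_pos he]
  rintro ⟨μ, hμ⟩
  exact Finset.singleton_ne_empty μ (hμ.symm.trans he)

theorem isInitial_ofSignals {A : Set (S × ℝ)} (hA : A.Finite)
    (hi : ∀ x μ ν, (μ, x) ∈ A → (ν, x) ∈ A → M.speed μ = M.speed ν → μ = ν) :
    M.IsInitial (M.ofSignals A) := by
  classical
  have hfin : (support (M.ofSignals A)).Finite := by
    refine (hA.image Prod.snd).subset fun x hx => ?_
    obtain ⟨μ, hμ⟩ := M.exists_mem_of_ofSignals_ne_void hx
    exact ⟨_, hμ, rfl⟩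
  refine ⟨⟨fun x _ _ => ?_, fun x hx => absurd hx (not_accPt_of_finite hfin x)⟩, hfin,
    fun x => (M.represents_ofSignals A x).1, fun x s hs => ?_⟩
  · have hcl : IsClosed (support (M.ofSignals A) \ {x}) :=
      (hfin.subset Set.sdiff_subset).isClosed
    obtain ⟨ε, hε, hball⟩ := Metric.isOpen_iff.1 hcl.isOpen_compl x (by simp)
    refine ⟨ε, hε, fun y hy hyε => ?_⟩
    by_contra hne
    refine hball (show y ∈ Metric.ball x ε by rwa [Metric.mem_ball', Real.dist_eq]) ⟨hne, ?_⟩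
    rintro rfl
    simp at hy
  · rw [ofSignals] at hs
    split_ifs at hs with h1 h2
    obtain rfl := Value.start.inj hs
    refine ⟨?_, fun μ hμ ν hν e => hi x μ ν (by simpa using hμ) (by simpa using hν) e⟩
    by_contra! hlt
    have hpos := Finset.card_pos.2 (Finset.nonempty_iff_ne_empty.2 h2)
    exact h1 (Finset.card_eq_one.1 (by omega))

theorem reaches_zero (A : Set (S × ℝ)) : M.Reaches (M.ofSignals A) 0 0 A :=
  ⟨rfl, M.represents_ofSignals A, fun _ h => absurd h (Nat.not_lt_zero _)⟩

end SignalMachine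

/-! ### The machine with speeds -1, 0, 1 -/

theorem range_speed_euclidMachine : Set.range euclidMachine.speed = {-1, 0, 1} := by
  ext x
  simp only [Set.mem_range, Set.mem_insert_iff, Set.mem_singleton_iff]
  constructor
  · rintro ⟨σ, rfl⟩
    cases σ <;> simp [euclidMachine, EuclidSignal.speed]
  · rintro (rfl | rfl | rfl)
    · exact ⟨.zag, rfl⟩
    · exact ⟨.wall0, rfl⟩
    · exact ⟨.zig, rfl⟩

theorem euclidMachine_dividesWith :
    euclidMachine.DividesWith (Function.Embedding.refl _) 1 where
  pos := one_pos
  speed σ := by cases σ <;> rfl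
  collide P Q h := by
    rw [Finset.map_refl, Finset.map_refl]
    show EuclidSignal.collide P = Q
    cases h <;> decide

theorem isInitial_euclidSignals {a b : ℝ} (hb : 0 < b) (hab : b < a) :
    euclidMachine.IsInitial (euclidMachine.ofSignals (euclidSignals a b)) := by
  have ha : 0 < a := hb.trans hab
  refine euclidMachine.isInitial_ofSignals (by simp [euclidSignals]) fun x μ ν hμ hν e => ?_
  simp only [euclidSignals, Set.mem_insert_iff, Set.mem_singleton_iff, Prod.mk.injEq] at hμ hν
  rcases hμ with ⟨rfl, rfl⟩ | ⟨rfl, rfl⟩ | ⟨rfl, rfl⟩ | ⟨rfl, rfl⟩ <;>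
    rcases hν with ⟨rfl, h⟩ | ⟨rfl, h⟩ | ⟨rfl, h⟩ | ⟨rfl, h⟩ <;>
    first
      | rfl
      | (exfalso; linarith)
      | simp [euclidMachine, EuclidSignal.speed] at e

/-! ### The machine with speeds -1, 0, φ -/

theorem range_speed_goldenMachine :
    Set.range goldenMachine.speed = {-1, 0, Real.goldenRatio} := by
  ext x
  simp only [Set.mem_range, Set.mem_insert_iff, Set.mem_singleton_iff]
  constructor
  · rintro ⟨σ, rfl⟩
    cases σ <;> simp [goldenMachine, GoldenSignal.speed]
  · rintro (rfl | rfl | rfl)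
    · exact ⟨.zag, rfl⟩
    · exact ⟨.wall0, rfl⟩
    · exact ⟨.zig, rfl⟩

/-- The signals of Euclid's algorithm in the machine with speeds `-1, 0, φ`. -/
def EuclidSignal.toGolden : EuclidSignal ↪ GoldenSignal where
  toFun
    | zig => .zig
    | bigZig => .bigZig
    | wall0 => .wall0
    | wallA => .wallA
    | wallB => .wallB
    | zag => .zag
    | bigZag => .bigZag
  inj' σ τ h := by cases σ <;> cases τ <;> first | rfl | cases h

theorem goldenMachine_dividesWith :
    goldenMachine.DividesWith EuclidSignal.toGolden Real.goldenRatio where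
  pos := Real.goldenRatio_pos
  speed σ := by cases σ <;> rfl
  collide P Q h := by
    show GoldenSignal.collide (P.map toGolden) = Q.map toGolden
    cases h <;> decide

/-- The worldlines of the signals that encode `1` and `φ - 1`. -/
def goldenStartWorldlines : GoldenSignal → Set Worldline
  -- The phase ends at time 1; the death time 2 stands for any later time.
  | .zig => {⟨-Real.goldenRatio, 1, 2⟩}
  | .bigZig => ∅
  | .init => {⟨0, 0, 2 - Real.goldenRatio⟩}
  | .wall0 => {⟨0, 0, 2⟩}
  | .wallA => {⟨1, 0, 2⟩}
  | .wallB => {⟨Real.goldenRatio - 1, 2 - Real.goldenRatio, 2⟩}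
  | .zag => {⟨1, 0, 1⟩}
  | .bigZag => ∅

open Real (goldenRatio)

/-- The signal of speed `φ` from 0 and the zag from 1 meet at time `1 / (1 + φ) = 2 - φ`, hence at
position `φ - 1`. -/
theorem goldenRatio_start :
    goldenRatio * (2 - goldenRatio) = goldenRatio - 1 := by
  linarith [Real.goldenRatio_sq, sq goldenRatio, mul_sub goldenRatio 2 goldenRatio]

theorem goldenStart_arriving {t x : ℝ} {μ : GoldenSignal} :
    μ ∈ goldenMachine.arriving goldenStartWorldlines t x ↔
      match μ with
      | .zig => 1 < t ∧ t ≤ 2 ∧ -goldenRatio + t * goldenRatio = x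
      | .bigZig => False
      | .init => 0 < t ∧ t ≤ 2 - goldenRatio ∧ t * goldenRatio = x
      | .wall0 => 0 < t ∧ t ≤ 2 ∧ 0 = x
      | .wallA => 0 < t ∧ t ≤ 2 ∧ 1 = x
      | .wallB => 2 - goldenRatio < t ∧ t ≤ 2 ∧ goldenRatio - 1 = x
      | .zag => 0 < t ∧ t ≤ 1 ∧ 1 - t = x
      | .bigZag => False := by
  rw [SignalMachine.mem_arriving]
  cases μ <;> simp [goldenStartWorldlines, goldenMachine, GoldenSignal.speed, ← sub_eq_add_neg]

theorem goldenStart_departing {t x : ℝ} {μ : GoldenSignal} :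
    μ ∈ goldenMachine.departing goldenStartWorldlines t x ↔
      match μ with
      | .zig => 1 ≤ t ∧ t < 2 ∧ -goldenRatio + t * goldenRatio = x
      | .bigZig => False
      | .init => 0 ≤ t ∧ t < 2 - goldenRatio ∧ t * goldenRatio = x
      | .wall0 => 0 ≤ t ∧ t < 2 ∧ 0 = x
      | .wallA => 0 ≤ t ∧ t < 2 ∧ 1 = x
      | .wallB => 2 - goldenRatio ≤ t ∧ t < 2 ∧ goldenRatio - 1 = x
      | .zag => 0 ≤ t ∧ t < 1 ∧ 1 - t = x
      | .bigZag => False := by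
  rw [SignalMachine.mem_departing]
  cases μ <;> simp [goldenStartWorldlines, goldenMachine, GoldenSignal.speed, ← sub_eq_add_neg]

theorem goldenStart_arriving_init :
    goldenMachine.arriving goldenStartWorldlines (2 - goldenRatio) (goldenRatio - 1) = {.init, .zag} := by
  have h1 := Real.one_lt_goldenRatio
  have h2 := Real.goldenRatio_lt_two
  have h3 := goldenRatio_start
  ext μ
  rw [goldenStart_arriving]
  cases μ <;> simp only [Finset.mem_insert, Finset.mem_singleton, reduceCtorEq, or_false, or_true,
    iff_false, iff_true]
  all_goals first
    | (rintro ⟨_, _, _⟩; linarith)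
    | (refine ⟨?_, ?_, ?_⟩ <;> first | trivial | linarith)

theorem goldenStart_arriving_wall :
    goldenMachine.arriving goldenStartWorldlines 1 0 = {.wall0, .zag} := by
  have h1 := Real.one_lt_goldenRatio
  have h2 := Real.goldenRatio_lt_two
  have h3 := goldenRatio_start
  ext μ
  rw [goldenStart_arriving]
  cases μ <;> simp only [Finset.mem_insert, Finset.mem_singleton, reduceCtorEq, or_false, or_true,
    iff_false, iff_true]
  all_goals first
    | (rintro ⟨_, _, _⟩; linarith)
    | (refine ⟨?_, ?_, ?_⟩ <;> first | trivial | linarith)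

theorem goldenStart_departing_init :
    goldenMachine.departing goldenStartWorldlines (2 - goldenRatio) (goldenRatio - 1) = {.zag, .wallB} := by
  have h1 := Real.one_lt_goldenRatio
  have h2 := Real.goldenRatio_lt_two
  have h3 := goldenRatio_start
  ext μ
  rw [goldenStart_departing]
  cases μ <;> simp only [Finset.mem_insert, Finset.mem_singleton, reduceCtorEq, or_false, or_true,
    iff_false, iff_true]
  all_goals first
    | (rintro ⟨_, _, _⟩; linarith)
    | (refine ⟨?_, ?_, ?_⟩ <;> first | trivial | linarith)

theorem goldenStart_departing_wall :
    goldenMachine.departing goldenStartWorldlines 1 0 = {.wall0, .zig} := by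
  have h1 := Real.one_lt_goldenRatio
  have h2 := Real.goldenRatio_lt_two
  have h3 := goldenRatio_start
  ext μ
  rw [goldenStart_departing]
  cases μ <;> simp only [Finset.mem_insert, Finset.mem_singleton, reduceCtorEq, or_false, or_true,
    iff_false, iff_true]
  all_goals first
    | (rintro ⟨_, _, _⟩; linarith)
    | (refine ⟨?_, ?_, ?_⟩ <;> first | trivial | linarith)

theorem goldenStart_departing_zero {x : ℝ} {μ : GoldenSignal} :
    μ ∈ goldenMachine.departing goldenStartWorldlines 0 x ↔ (μ, x) ∈ goldenStart := by
  have h2 := Real.goldenRatio_lt_two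
  rw [goldenStart_departing]
  simp only [goldenStart, Set.mem_insert_iff, Set.mem_singleton_iff, Prod.mk.injEq]
  cases μ <;> simp only [reduceCtorEq, false_and, true_and, or_false, false_or, iff_false]
  case zig => rintro ⟨h, -⟩; linarith
  case wallB => rintro ⟨h, -⟩; linarith
  all_goals
    constructor
    · rintro ⟨-, -, h⟩; linarith
    · rintro rfl; exact ⟨by linarith, by linarith, by linarith⟩

theorem goldenStart_departing_one {x : ℝ} {μ : GoldenSignal} :
    μ ∈ goldenMachine.departing goldenStartWorldlines 1 x ↔
      (μ, x) ∈ goldenSignals 1 (goldenRatio - 1) := by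
  have h1 := Real.one_lt_goldenRatio
  have h2 := Real.goldenRatio_lt_two
  rw [goldenStart_departing]
  simp only [goldenSignals, Set.mem_insert_iff, Set.mem_singleton_iff, Prod.mk.injEq]
  cases μ <;> simp only [reduceCtorEq, false_and, true_and, or_false, false_or, iff_false]
  case init => rintro ⟨-, h, -⟩; linarith
  case zag => rintro ⟨-, h, -⟩; linarith
  all_goals
    constructor
    · rintro ⟨-, -, h⟩; linarith
    · rintro rfl; exact ⟨by linarith, by linarith, by linarith⟩

theorem goldenStart_meet {t x : ℝ} {μ ν : GoldenSignal} (h0 : 0 < t) (ht : t ≤ 1) (hne : μ ≠ ν)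
    (hμ : μ ∈ goldenMachine.arriving goldenStartWorldlines t x)
    (hν : ν ∈ goldenMachine.arriving goldenStartWorldlines t x) :
    (t = 2 - goldenRatio ∧ x = goldenRatio - 1) ∨ (t = 1 ∧ x = 0) := by
  have h1 := Real.one_lt_goldenRatio
  have h2 := Real.goldenRatio_lt_two
  have h3 := goldenRatio_start
  have hpos := mul_pos h0 Real.goldenRatio_pos
  have hmul : t ≤ 2 - goldenRatio → t * goldenRatio ≤ goldenRatio - 1 := fun h => by
    have := mul_le_mul_of_nonneg_right h Real.goldenRatio_pos.le
    linarith
  -- Both sides become 1 after multiplication by `1 + φ`. With `hmul`, this settles the products `t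
  -- * φ`, so that the pairs of signals can be treated linearly.
  have hmeet : t * goldenRatio = 1 - t → t = 2 - goldenRatio := fun h =>
    mul_right_cancel₀ (show 1 + goldenRatio ≠ 0 by linarith) (by linarith)
  rw [goldenStart_arriving] at hμ hν
  cases μ <;> cases ν <;>
    first
      | exact absurd rfl hne
      | exact hμ.elim
      | exact hν.elim
      | (obtain ⟨a1, a2, a3⟩ := hμ
         obtain ⟨b1, b2, b3⟩ := hν
         first
           | (exfalso; linarith)
           | (exfalso; linarith [hmul a2])
           | (exfalso; linarith [hmul b2])
           | exact Or.inr ⟨by linarith, by linarith⟩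
           | (have := hmeet (by linarith); exact Or.inl ⟨this, by linarith⟩))

/-- The initial phase, in which the distances `1` and `φ - 1` are produced. -/
theorem goldenStart_isEvolution : goldenMachine.IsEvolution goldenStartWorldlines 1
    fun t x => (t = 2 - goldenRatio ∧ x = goldenRatio - 1) ∨ (t = 1 ∧ x = 0) where
  finite μ := by cases μ <;> simp [goldenStartWorldlines]
  birth μ l hl h0 h1 := by
    have := goldenRatio_start
    cases μ <;> simp only [goldenStartWorldlines, Set.mem_singleton_iff, Set.mem_empty_iff_false]
      at hl <;> subst hl
    case wallB => exact Or.inl ⟨rfl, by simp [goldenMachine, GoldenSignal.speed]⟩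
    case zig => exact Or.inr ⟨rfl, by simp [goldenMachine, GoldenSignal.speed]⟩
    all_goals exact absurd h0 (lt_irrefl _)
  death μ l hl h0 h1 := by
    have := goldenRatio_start
    cases μ <;> simp only [goldenStartWorldlines, Set.mem_singleton_iff, Set.mem_empty_iff_false]
      at hl <;> subst hl
    case init =>
      refine Or.inl ⟨rfl, ?_⟩
      simp only [goldenMachine, GoldenSignal.speed]
      linarith
    case zag => exact Or.inr ⟨rfl, by simp [goldenMachine, GoldenSignal.speed]⟩
    all_goals exact absurd h1 (by norm_num)
  meet _ _ _ _ h0 h1 hne hμ hν := goldenStart_meet h0 h1 hne hμ hν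
  two_le_card := by
    rintro t x - - (⟨rfl, rfl⟩ | ⟨rfl, rfl⟩)
    · rw [goldenStart_arriving_init]; decide
    · rw [goldenStart_arriving_wall]; decide
  injOn := by
    have h := Real.goldenRatio_pos
    rintro t x - - (⟨rfl, rfl⟩ | ⟨rfl, rfl⟩)
    · rw [goldenStart_arriving_init, Finset.coe_pair, Set.injOn_pair]
      intro e
      simp only [goldenMachine, GoldenSignal.speed] at e
      linarith
    · rw [goldenStart_arriving_wall, Finset.coe_pair, Set.injOn_pair]
      intro e
      simp [goldenMachine, GoldenSignal.speed] at e
  collide := by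
    rintro t x - - (⟨rfl, rfl⟩ | ⟨rfl, rfl⟩)
    · rw [goldenStart_arriving_init, goldenStart_departing_init]
      exact (show GoldenSignal.collide {.init, .zag} = {.zag, .wallB} by decide).symm
    · rw [goldenStart_arriving_wall, goldenStart_departing_wall]
      exact (show GoldenSignal.collide {.wall0, .zag} = {.wall0, .zig} by decide).symm

theorem isInitial_goldenStart :
    goldenMachine.IsInitial (goldenMachine.ofSignals goldenStart) := by
  have h := Real.goldenRatio_pos
  refine goldenMachine.isInitial_ofSignals (by simp [goldenStart]) fun x μ ν hμ hν e => ?_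
  simp only [goldenStart, Set.mem_insert_iff, Set.mem_singleton_iff, Prod.mk.injEq] at hμ hν
  rcases hμ with ⟨rfl, rfl⟩ | ⟨rfl, rfl⟩ | ⟨rfl, rfl⟩ | ⟨rfl, rfl⟩ <;>
    rcases hν with ⟨rfl, h'⟩ | ⟨rfl, h'⟩ | ⟨rfl, h'⟩ | ⟨rfl, h'⟩ <;>
    first
      | rfl
      | (exfalso; linarith)
      | (simp only [goldenMachine, GoldenSignal.speed] at e; exfalso; linarith)

theorem goldenStart_reaches : ∃ n, goldenMachine.Reaches (goldenMachine.ofSignals goldenStart) n 1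
    (SignalMachine.encoding EuclidSignal.toGolden 1 (goldenRatio - 1)) := by
  obtain ⟨⟨n, -, h⟩, -⟩ := (goldenMachine.reaches_zero goldenStart).run goldenStart_isEvolution
    one_pos ⟨0, Or.inr ⟨rfl, rfl⟩⟩ (fun _ _ => goldenStart_departing_zero)
    (fun _ _ => goldenStart_departing_one)
  exact ⟨n, by rwa [zero_add] at h⟩

end

/-! ### The two machines accumulate -/

open Real (goldenRatio)
open SignalMachine in
/-- The machine with speeds `-1, 0, 1` on incommensurate distances. -/
theorem euclidMachine_accumulates {a b : ℝ} (hb : 0 < b) (hab : b < a)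
    (hirr : Irrational (a / b)) :
    (∀ n : ℕ, Represents (euclidMachine.diagram (euclidMachine.ofSignals (euclidSignals a b))
        (∑ i ∈ Finset.range n, 2 * euclidA a b i))
        (euclidSignals (euclidA a b n) (euclidB a b n))) ∧
      ∃ T : ℝ, HasSum (fun n => 2 * euclidA a b n) T ∧
        euclidMachine.ProducesAccumulationAt
          (euclidMachine.ofSignals (euclidSignals a b)) 0 T := by
  have hr : euclidMachine.Reaches (euclidMachine.ofSignals (euclidSignals a b)) 0 0
      (encoding (Function.Embedding.refl _) a b) := euclidMachine.reaches_zero _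
  have h2 : (1 : ℝ) + 1 / 1 = 2 := by norm_num
  constructor
  · intro n
    have := euclidMachine_dividesWith.represents hb hab hirr hr n
    rwa [divisionTime, zero_add, h2] at this
  · obtain ⟨T, hT, hacc⟩ := euclidMachine_dividesWith.producesAccumulationAt hb hab hirr hr
    rw [h2] at hT
    rw [zero_add] at hacc
    exact ⟨T, hT, hacc⟩

/-- Since `φ * (φ - 1) = 1`, the ratio of the distances built by the initial phase is `φ` itself. -/
theorem irrational_one_div_goldenRatio_sub_one : Irrational (1 / (goldenRatio - 1)) := by
  have h1 := Real.one_lt_goldenRatio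
  have : 1 / (goldenRatio - 1) = goldenRatio := by
    rw [div_eq_iff (by linarith)]
    linarith [Real.goldenRatio_sq, sq goldenRatio, mul_sub goldenRatio goldenRatio 1]
  rw [this]
  exact Real.goldenRatio_irrational

theorem mainTheorem2 :
    -- the machine with speeds -1, 0, 1, started on incommensurate distances
    (euclidMachine.IsNSpeed 3 ∧ Set.range euclidMachine.speed = {-1, 0, 1} ∧
      ∀ a b : ℝ, 0 < b → b < a → Irrational (a / b) →
        euclidMachine.IsInitial (euclidMachine.ofSignals (euclidSignals a b)) ∧
        ¬ EuclidHalts a b ∧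
        (∀ n : ℕ, SignalMachine.Represents
          (euclidMachine.diagram (euclidMachine.ofSignals (euclidSignals a b))
            (∑ i ∈ Finset.range n, 2 * euclidA a b i))
          (euclidSignals (euclidA a b n) (euclidB a b n))) ∧
        ∃ T : ℝ, HasSum (fun n => 2 * euclidA a b n) T ∧
          euclidMachine.ProducesAccumulationAt
            (euclidMachine.ofSignals (euclidSignals a b)) 0 T) ∧
    -- in particular, the distances φ and 1
    (Irrational (Real.goldenRatio / 1) ∧
      ∃ T : ℝ, euclidMachine.ProducesAccumulationAt
        (euclidMachine.ofSignals (euclidSignals Real.goldenRatio 1)) 0 T) ∧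
    -- the machine with speeds -1, 0, φ, started on a rational configuration
    (goldenMachine.IsNSpeed 3 ∧ Set.range goldenMachine.speed = {-1, 0, Real.goldenRatio} ∧
      Irrational (Real.goldenRatio / (-1)) ∧
      goldenMachine.IsInitial (goldenMachine.ofSignals goldenStart) ∧
      (∀ x ∈ SignalMachine.support (goldenMachine.ofSignals goldenStart), ∃ q : ℚ, x = (q : ℝ)) ∧
      ¬ EuclidHalts 1 (Real.goldenRatio - 1) ∧
      (∀ n : ℕ, SignalMachine.Represents
        (goldenMachine.diagram (goldenMachine.ofSignals goldenStart)
          (1 + ∑ i ∈ Finset.range n,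
            (1 + 1 / Real.goldenRatio) * euclidA 1 (Real.goldenRatio - 1) i))
        (goldenSignals (euclidA 1 (Real.goldenRatio - 1) n)
          (euclidB 1 (Real.goldenRatio - 1) n))) ∧
      ∃ T : ℝ,
        HasSum (fun n => (1 + 1 / Real.goldenRatio) * euclidA 1 (Real.goldenRatio - 1) n) T ∧
        goldenMachine.ProducesAccumulationAt
          (goldenMachine.ofSignals goldenStart) 0 (1 + T)) := by
  have hφ := Real.one_lt_goldenRatio
  have hφ2 := Real.goldenRatio_lt_two
  refine ⟨⟨?_, range_speed_euclidMachine, fun a b hb hab hirr =>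
    ⟨isInitial_euclidSignals hb hab, not_euclidHalts hb hab hirr,
      euclidMachine_accumulates hb hab hirr⟩⟩, ?_, ?_, range_speed_goldenMachine, ?_,
    isInitial_goldenStart, ?_, ?_, ?_⟩
  · rw [SignalMachine.IsNSpeed, range_speed_euclidMachine, Set.ncard_eq_three]
    exact ⟨-1, 0, 1, by norm_num, by norm_num, by norm_num, rfl⟩
  · have hirr : Irrational (goldenRatio / 1) := by simpa using Real.goldenRatio_irrational
    obtain ⟨-, T, -, hT⟩ := euclidMachine_accumulates one_pos hφ hirr
    exact ⟨hirr, T, hT⟩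
  · rw [SignalMachine.IsNSpeed, range_speed_goldenMachine, Set.ncard_eq_three]
    exact ⟨-1, 0, goldenRatio, by norm_num, by linarith, by linarith, rfl⟩
  · rw [div_neg, div_one]
    exact Real.goldenRatio_irrational.neg
  · intro x hx
    obtain ⟨μ, hμ⟩ := goldenMachine.exists_mem_of_ofSignals_ne_void hx
    simp only [goldenStart, Set.mem_insert_iff, Set.mem_singleton_iff, Prod.mk.injEq] at hμ
    rcases hμ with ⟨-, rfl⟩ | ⟨-, rfl⟩ | ⟨-, rfl⟩ | ⟨-, rfl⟩
    · exact ⟨0, by simp⟩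
    · exact ⟨0, by simp⟩
    · exact ⟨1, by simp⟩
    · exact ⟨1, by simp⟩
  · exact not_euclidHalts (by linarith) (by linarith) irrational_one_div_goldenRatio_sub_one
  · obtain ⟨n₀, hr⟩ := goldenStart_reaches
    exact ⟨goldenMachine_dividesWith.represents (by linarith) (by linarith)
        irrational_one_div_goldenRatio_sub_one hr,
      goldenMachine_dividesWith.producesAccumulationAt (by linarith) (by linarith)
        irrational_one_div_goldenRatio_sub_one hr⟩
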